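/- For integers $N,d,\omega\ge 0$ let $\mathcal G(N,d,\omega)$ be the collection of chordal graphs (graphs with no induced cycle of length four or more) on the vertex set $\{1,\dots,N\}$ with maximum degree at most $d$ and clique number at most $\omega$, and let $\mathsf{cc}(G)$ be the number of connected components of $G$. For $0<p\le 1$ let $S$ be a random set containing each vertex independently with probability $p$, put $q=1-p$, and let $\widetilde G=G[S]$ be the observed induced subgraph on $S$. Let $$R(N,d,\omega,p)=\inf_{\widehat{\mathsf{cc}}}\ \sup_{G\in\mathcal G(N,d,\omega)}\mathbb E_G\big|\widehat{\mathsf{cc}}(\widetilde G)-\mathsf{cc}(G)\big|^2 ,$$ the infimum being over all real-valued functions $\widehat{\mathsf{cc}}$ of the observation $\widetilde G=(S,E[S])$ (which may depend on the known parameters $N,d,\omega,p$), and let $$r(N,d,\omega,p)=\Big(\frac{N}{p^{\omega}}\vee\frac{Nd}{p^{\omega-1}}\Big)\wedge N^2 .$$ Then: 1. For every $\omega\ge 2$ there is a constant $C_\omega>0$ such that $R(N,d,\omega,p)\le C_\omega\, r(N,d,\omega,p)$ for all $N,d\ge 0$ and all $0<p\le 1$. 2. For every $\omega\ge 2$ there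 are constants $0<p_0(\omega)<\tfrac12$ and $c_\omega>0$ such that $R(N,d,\omega,p)\ge c_\omega\, r(N,d,\omega,p)$ for all $N\ge 2$, all $d\ge\omega-1$ and all $0<p\le p_0(\omega)$. 3. If $\tfrac12\le p\le 1$, then $R(N,d,\omega,p)\le N\,\tfrac{q}{p}\,(d+1)$ for all integers $N,d,\omega\ge 0$ (the supremum over an empty class being $0$). -/

import Mathlib

namespace SubgraphSampling

noncomputable section

/-- A graph is chordal if no induced subgraph is a cycle of length four or above. -/
def IsChordal {V : Type*} (G : SimpleGraph V) : Prop :=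
  ∀ k : ℕ, 4 ≤ k → IsEmpty (SimpleGraph.cycleGraph k ↪g G)

/-- The number of connected components. -/
def cc {V : Type*} (G : SimpleGraph V) : ℕ :=
  Nat.card G.ConnectedComponent

open Classical in
/-- The chordal graphs on `N` vertices with maximum degree at most `d` and clique number at
most `ω`. -/
def chordalClass (N d ω : ℕ) : Set (SimpleGraph (Fin N)) :=
  {G | IsChordal G ∧ G.maxDegree ≤ d ∧ G.cliqueNum ≤ ω}

/-- An estimator: an arbitrary real function of the observation, which consists of the set `S` of
sampled vertices and of a graph on `S` (the induced subgraph). -/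
abbrev Estimator (N : ℕ) : Type :=
  (S : Finset (Fin N)) → SimpleGraph (S : Set (Fin N)) → ℝ

/-- The probability that the set of sampled vertices is exactly `S`, when each of the `N` vertices
is sampled independently with probability `p`. -/
def samplingProb {N : ℕ} (p : ℝ) (S : Finset (Fin N)) : ℝ :=
  ∏ v : Fin N, if v ∈ S then p else 1 - p

/-- The mean squared error of an estimator of the number of components when the parent graph
is `G`. -/
def mse {N : ℕ} (p : ℝ) (est : Estimator N) (G : SimpleGraph (Fin N)) : ℝ :=
  ∑ S : Finset (Fin N),
    samplingProb p S * (est S (G.induce (S : Set (Fin N))) - (cc G : ℝ)) ^ 2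

/-- The minimax mean squared error over the class. The supremum is over a finite type, and for
`0 ≤ p ≤ 1` all the values are nonnegative, so that the supremum and the infimum of reals are
the true ones. -/
def minimaxRisk (N d ω : ℕ) (p : ℝ) : ℝ :=
  ⨅ est : Estimator N, ⨆ G : chordalClass N d ω, mse p est (G : SimpleGraph (Fin N))

/-- The rate `(N / p ^ ω ∨ N d / p ^ (ω - 1)) ∧ N ^ 2` (used for `1 ≤ ω` and `0 < p` only). -/
def rate (N d ω : ℕ) (p : ℝ) : ℝ :=
  min (max ((N : ℝ) / p ^ ω) ((N : ℝ) * (d : ℝ) / p ^ (ω - 1))) ((N : ℝ) ^ 2)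

end

end SubgraphSampling

/-!
Both bounds rest on perfect elimination orderings: by Dirac's theorem a chordal graph has an
ordering of its vertices in which the set `N v` of earlier neighbours of each vertex `v` is a clique
(`IsChordal.exists_isPEO`). Its components then correspond to the vertices with `N v = ∅`
(`IsPEO.cc_eq`), and its nonempty cliques are the sets `{v} ∪ T` with `T ⊆ N v`.

Upper bounds. The estimator is the alternating count of observed cliques, each weighted by the
inverse of its sampling probability. With the centred variables `ξ v = 1 - 𝟙[v ∈ S] / p`, it equals
`∑ v, (ξ ^ N v - ξ ^ ({v} ∪ N v))`, where `ξ ^ A` is the product of `ξ` over `A`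
(`IsPEO.cliqueEstimator_eq`). The `ξ ^ A` are orthogonal, of squared norm `(q / p) ^ |A|`, so the
mean squared error is a sum of squared coefficients, in which each nonempty `A` is `N v` for at most
`d` vertices `v` and is `{v} ∪ N v` for at most one (`IsPEO.mse_cliqueEstimator_le`). The constant
estimator `0` gives the bound `N ^ 2`.

Lower bound. The vertices are divided into `M` blocks, each with a core, which is a clique on `k`
vertices, and `ℓ` further vertices, all joined to the same subset `T b` of the core. The number of
components is a constant plus `ℓ` times the number of empty `T b`, while the parity of `|T b|` is
invisible unless the whole core is sampled, together with the further vertex if `ℓ = 1`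
(`blockFamily`). The uniform law on the family is compared with the law that biases every parity
by `δ`. This moves the mean number of components by `ℓ M δ / 2 ^ k`, but moves the law of the
observation little as long as `M δ² p ^ a ≤ 1`, where `a` is the number of vertices that reveal a
parity. A Cauchy–Schwarz argument (`HiddenParity.le_of_mse_le`) yields a risk of order
`ℓ² M min (M, p ^ (-a))`. With `k = ω - 1`, the choice `ℓ = 1`, `a = ω` gives the term `N / p ^ ω`,
and the largest `ℓ` that the degree bound and `N` allow, with `a = ω - 1`, gives `N d / p ^ (ω - 1)`.
-/

namespace SubgraphSampling

/-! ### Perfect elimination orderings of chordal graphs -/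

/-- The graph `G` with only those edges kept that have both ends in `Z`. -/
def restrictTo {V : Type*} (G : SimpleGraph V) (Z : Set V) : SimpleGraph V where
  Adj a b := G.Adj a b ∧ a ∈ Z ∧ b ∈ Z
  symm := ⟨fun _ _ h => ⟨h.1.symm, h.2.2, h.2.1⟩⟩
  loopless := ⟨fun _ h => h.1.ne rfl⟩

lemma cycleGraph_add_two_adj {n : ℕ} (i j : Fin (n + 2)) :
    (SimpleGraph.cycleGraph (n + 2)).Adj i j ↔
      i.val + 1 = j ∨ j.val + 1 = i ∨ (i.val = 0 ∧ j.val = n + 1) ∨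
        (j.val = 0 ∧ i.val = n + 1) := by
  rw [SimpleGraph.cycleGraph_adj', Fin.sub_def, Fin.sub_def]
  have hi := i.2
  have hj := j.2
  simp only
  rcases lt_trichotomy i.val j.val with h1 | h1 | h1
  · rw [Nat.mod_eq_of_lt (by omega : n + 2 - j.val + i < n + 2),
      Nat.mod_eq_sub_mod (by omega), Nat.mod_eq_of_lt (by omega)]
    omega
  · rw [h1, Nat.mod_eq_sub_mod (by omega), Nat.mod_eq_of_lt (by omega)]
    omega
  · rw [Nat.mod_eq_of_lt (by omega : n + 2 - i.val + j < n + 2),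
      Nat.mod_eq_sub_mod (by omega), Nat.mod_eq_of_lt (by omega)]
    omega

/-- In a chordal graph, two neighbours of `v` that are joined by a path whose interior `Z` avoids
`v` and its neighbours are adjacent: otherwise a shortest such path closes up through `v` to an
induced cycle of length at least four. -/
lemma IsChordal.adj_of_reachable {V : Type*} {G : SimpleGraph V} (hG : IsChordal G)
    {v x y : V} (hx : G.Adj v x) (hy : G.Adj v y) (hxy : x ≠ y) {Z : Set V}
    (hZ : ∀ z ∈ Z, z ≠ v ∧ ¬ G.Adj v z)
    (hr : (restrictTo G (Z ∪ {x, y})).Reachable x y) : G.Adj x y := by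
  by_contra hnadj
  obtain ⟨H, hH⟩ : ∃ H, H = restrictTo G (Z ∪ {x, y}) := ⟨_, rfl⟩
  rw [← hH] at hr
  obtain ⟨p, hp⟩ := hr.exists_walk_length_eq_dist
  obtain ⟨n, hn⟩ : ∃ n, n = p.length := ⟨_, rfl⟩
  -- Replacing a piece of `p` by another walk cannot make it shorter.
  have short : ∀ i j, i ≤ n → j ≤ n → ∀ q : H.Walk (p.getVert i) (p.getVert j),
      j ≤ i + q.length := by
    intro i j hi hj q
    have h := SimpleGraph.dist_le ((p.take i).append (q.append (p.drop j)))
    rw [SimpleGraph.Walk.length_append, SimpleGraph.Walk.length_append,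
      SimpleGraph.Walk.take_length, SimpleGraph.Walk.drop_length, ← hp,
      ← hn, min_eq_left hi] at h
    omega
  have hinj : ∀ i j, i ≤ n → j ≤ n → p.getVert i = p.getVert j → j ≤ i := by
    intro i j hi hj h
    have := short i j hi hj ((SimpleGraph.Walk.nil : H.Walk _ _).copy rfl h)
    simpa using this
  have hadj : ∀ i j, i ≤ n → j ≤ n → H.Adj (p.getVert i) (p.getVert j) → j ≤ i + 1 := by
    intro i j hi hj h
    simpa using short i j hi hj (SimpleGraph.Walk.cons h SimpleGraph.Walk.nil)
  have hsucc : ∀ i, i < n → H.Adj (p.getVert i) (p.getVert (i + 1)) :=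
    fun i hi => p.adj_getVert_succ (hn ▸ hi)
  subst hH
  have h0 : p.getVert 0 = x := p.getVert_zero
  have hlast : p.getVert n = y := hn ▸ p.getVert_length
  have hn2 : 2 ≤ n := by
    by_contra hlt
    have hcases : n = 0 ∨ n = 1 := by omega
    rcases hcases with h | h
    · rw [h, h0] at hlast
      exact hxy hlast
    · have := hsucc 0 (by omega)
      rw [zero_add, h0, ← h, hlast] at this
      exact hnadj this.1
  have hmem : ∀ i, i ≤ n → p.getVert i ∈ Z ∪ {x, y} := by
    intro i hi
    rcases Nat.lt_or_ge i n with h | h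
    · exact (hsucc i h).2.1
    · have : i = n := by omega
      rw [this, hlast]
      simp
  have hne : ∀ i, i ≤ n → p.getVert i ≠ v := by
    intro i hi h
    rcases hmem i hi with hz | hz | hz
    · exact (hZ _ hz).1 h
    · rw [h] at hz
      exact hx.ne hz
    · rw [h] at hz
      exact hy.ne hz
  have hv : ∀ i, i ≤ n → (G.Adj v (p.getVert i) ↔ i = 0 ∨ i = n) := by
    intro i hi
    constructor
    · intro h
      rcases hmem i hi with hz | hz | hz
      · exact absurd h (hZ _ hz).2
      · left
        have := hinj 0 i (by omega) hi (by rw [h0]; exact hz.symm)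
        omega
      · right
        have := hinj i n hi le_rfl (by rw [hlast]; exact hz)
        omega
    · rintro (rfl | rfl)
      · rwa [h0]
      · rwa [hlast]
  have hHG : ∀ i j, i ≤ n → j ≤ n →
      (G.Adj (p.getVert i) (p.getVert j) ↔ i + 1 = j ∨ j + 1 = i) := by
    intro i j hi hj
    constructor
    · intro h
      have h1 := hadj i j hi hj ⟨h, hmem i hi, hmem j hj⟩
      have h2 := hadj j i hj hi ⟨h.symm, hmem j hj, hmem i hi⟩
      have h3 : i ≠ j := by
        rintro rfl
        exact h.ne rfl
      omega
    · rintro (rfl | rfl)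
      · exact (hsucc i (by omega)).1
      · exact (hsucc j (by omega)).1.symm
  let f : Fin (n + 2) → V := fun i => if i.val ≤ n then p.getVert i else v
  have hf : Function.Injective f := by
    intro i j hij
    have hi := i.2
    have hj := j.2
    simp only [f] at hij
    split_ifs at hij with h1 h2 h2
    · have ha := hinj i j h1 h2 hij
      have hb := hinj j i h2 h1 hij.symm
      exact Fin.ext (by omega)
    · exact absurd hij (hne _ h1)
    · exact absurd hij.symm (hne _ h2)
    · exact Fin.ext (by omega)
  have hfadj : ∀ i j, G.Adj (f i) (f j) ↔ (SimpleGraph.cycleGraph (n + 2)).Adj i j := by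
    intro i j
    have hi := i.2
    have hj := j.2
    rw [cycleGraph_add_two_adj]
    simp only [f]
    split_ifs with h1 h2 h2
    · rw [hHG i j h1 h2]
      omega
    · rw [G.adj_comm, hv i h1]
      omega
    · rw [hv j h2]
      omega
    · simp only [SimpleGraph.irrefl, false_iff]
      omega
  exact (hG (n + 2) (by omega)).false ⟨⟨f, hf⟩, hfadj _ _⟩

/-- A vertex of `W` is simplicial in `W` if its neighbours in `W` are pairwise adjacent. -/
def IsSimplicialIn {V : Type*} (G : SimpleGraph V) (W : Finset V) (v : V) : Prop :=
  ∀ a ∈ W, ∀ b ∈ W, G.Adj v a → G.Adj v b → a ≠ b → G.Adj a b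

/-- Dirac's theorem on simplicial vertices. If `v` does not dominate `W`, let `C` be a component of
what is left of `W` outside the closed neighbourhood of `v`, and `X` the set of neighbours of `C`
in the rest of `W`; then `X` is a clique, and induction applies to `C ∪ X` or to `C`. -/
lemma IsChordal.exists_simplicial_not_adj {V : Type*} {G : SimpleGraph V} (hG : IsChordal G) :
    ∀ (W : Finset V) (v : V), v ∈ W → (∃ w ∈ W, w ≠ v ∧ ¬ G.Adj v w) →
      ∃ z ∈ W, z ≠ v ∧ ¬ G.Adj v z ∧ IsSimplicialIn G W z := by
  classical
  intro W
  induction W using Finset.strongInduction with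
  | H W ih =>
  rintro v hvW ⟨c₀, hc₀W, hc₀v, hc₀⟩
  let Z : Set V := {z | z ∈ W ∧ z ≠ v ∧ ¬ G.Adj v z}
  let H := restrictTo G Z
  let C : Finset V := W.filter (fun z => z ∈ Z ∧ H.Reachable c₀ z)
  let X : Finset V := W.filter (fun x => x ∉ C ∧ ∃ c ∈ C, G.Adj x c)
  have hCZ : ∀ c ∈ C, c ∈ Z := fun c hc => (Finset.mem_filter.1 hc).2.1
  have hc₀C : c₀ ∈ C :=
    Finset.mem_filter.2 ⟨hc₀W, ⟨hc₀W, hc₀v, hc₀⟩, SimpleGraph.Reachable.refl _⟩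
  have hCW : C ⊆ W := Finset.filter_subset _ _
  have hXW : X ⊆ W := Finset.filter_subset _ _
  have hclosed : ∀ c ∈ C, ∀ z ∈ W, G.Adj c z → z ∈ C ∪ X := by
    intro c hc z hz hcz
    by_cases hzC : z ∈ C
    · exact Finset.mem_union_left _ hzC
    · exact Finset.mem_union_right _ (Finset.mem_filter.2 ⟨hz, hzC, c, hc, hcz.symm⟩)
  have hXv : ∀ x ∈ X, G.Adj v x := by
    intro x hx
    obtain ⟨hxW, hxC, c, hc, hxc⟩ := Finset.mem_filter.1 hx
    by_contra hvx
    have hxv : x ≠ v := by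
      rintro rfl
      exact (hCZ c hc).2.2 hxc
    have hxZ : x ∈ Z := ⟨hxW, hxv, hvx⟩
    refine hxC (Finset.mem_filter.2 ⟨hxW, hxZ, ?_⟩)
    exact (Finset.mem_filter.1 hc).2.2.trans
      (SimpleGraph.Adj.reachable ⟨hxc.symm, hCZ c hc, hxZ⟩)
  have hXclique : ∀ x ∈ X, ∀ y ∈ X, x ≠ y → G.Adj x y := by
    intro x hx y hy hxy
    refine hG.adj_of_reachable (hXv x hx) (hXv y hy) hxy (Z := Z) (fun z hz => hz.2) ?_
    obtain ⟨_, -, c, hc, hxc⟩ := Finset.mem_filter.1 hx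
    obtain ⟨_, -, c', hc', hyc'⟩ := Finset.mem_filter.1 hy
    have hle : H ≤ restrictTo G (Z ∪ {x, y}) :=
      fun a b hab => ⟨hab.1, Or.inl hab.2.1, Or.inl hab.2.2⟩
    have hcc' : H.Reachable c c' :=
      (Finset.mem_filter.1 hc).2.2.symm.trans (Finset.mem_filter.1 hc').2.2
    refine SimpleGraph.Reachable.trans (SimpleGraph.Adj.reachable ?_)
      ((hcc'.mono hle).trans (SimpleGraph.Adj.reachable ?_))
    · exact ⟨hxc, by simp, Or.inl (hCZ c hc)⟩
    · exact ⟨hyc'.symm, Or.inl (hCZ c' hc'), by simp⟩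
  have hlift : ∀ c ∈ C, IsSimplicialIn G (C ∪ X) c → IsSimplicialIn G W c := by
    intro c hc h a ha b hb hca hcb hab
    exact h a (hclosed c hc a ha hca) b (hclosed c hc b hb hcb) hca hcb hab
  suffices h : ∃ c ∈ C, IsSimplicialIn G (C ∪ X) c by
    obtain ⟨c, hc, hs⟩ := h
    exact ⟨c, hCW hc, (hCZ c hc).2.1, (hCZ c hc).2.2, hlift c hc hs⟩
  have hvCX : v ∉ C ∪ X := by
    intro h
    rcases Finset.mem_union.1 h with h | h
    · exact (hCZ v h).2.1 rfl
    · exact (hXv v h).ne rfl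
  have hss : C ∪ X ⊂ W :=
    (Finset.ssubset_iff_of_subset (Finset.union_subset hCW hXW)).2 ⟨v, hvW, hvCX⟩
  by_cases hdom : ∀ x ∈ X, ∀ w ∈ C ∪ X, w ≠ x → G.Adj x w
  · -- Every vertex of `X` dominates, so a simplicial vertex of `C` alone will do.
    have hCs : ∃ c ∈ C, IsSimplicialIn G C c := by
      by_cases hcl : ∀ w ∈ C, w ≠ c₀ → G.Adj c₀ w
      · by_cases hall : ∀ a ∈ C, ∀ b ∈ C, a ≠ b → G.Adj a b
        · exact ⟨c₀, hc₀C, fun a ha b hb _ _ hab => hall a ha b hb hab⟩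
        · push Not at hall
          obtain ⟨a, ha, b, hb, hab, hnab⟩ := hall
          obtain ⟨z, hz, -, -, hzs⟩ := ih C (lt_of_le_of_lt Finset.subset_union_left hss) a ha
            ⟨b, hb, hab.symm, hnab⟩
          exact ⟨z, hz, hzs⟩
      · push Not at hcl
        obtain ⟨w, hw, hwc, hnw⟩ := hcl
        obtain ⟨z, hz, -, -, hzs⟩ := ih C (lt_of_le_of_lt Finset.subset_union_left hss) c₀ hc₀C
          ⟨w, hw, hwc, hnw⟩
        exact ⟨z, hz, hzs⟩
    obtain ⟨c, hc, hs⟩ := hCs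
    refine ⟨c, hc, fun a ha b hb hca hcb hab => ?_⟩
    by_cases haX : a ∈ X
    · exact hdom a haX b hb hab.symm
    by_cases hbX : b ∈ X
    · exact (hdom b hbX a ha hab).symm
    have haC : a ∈ C := (Finset.mem_union.1 ha).resolve_right haX
    have hbC : b ∈ C := (Finset.mem_union.1 hb).resolve_right hbX
    exact hs a haC b hbC hca hcb hab
  · push Not at hdom
    obtain ⟨x, hx, w, hw, hwx, hxw⟩ := hdom
    obtain ⟨z, hz, hzx, hxz, hs⟩ := ih (C ∪ X) hss x (Finset.mem_union_right _ hx)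
      ⟨w, hw, hwx, hxw⟩
    refine ⟨z, (Finset.mem_union.1 hz).resolve_right fun hzX => ?_, hs⟩
    exact hxz (hXclique x hx z hzX hzx.symm)

lemma IsChordal.exists_simplicial {V : Type*} {G : SimpleGraph V} (hG : IsChordal G)
    {W : Finset V} (hW : W.Nonempty) : ∃ z ∈ W, IsSimplicialIn G W z := by
  by_cases hall : ∀ a ∈ W, ∀ b ∈ W, a ≠ b → G.Adj a b
  · obtain ⟨z, hz⟩ := hW
    exact ⟨z, hz, fun a ha b hb _ _ hab => hall a ha b hb hab⟩
  · push Not at hall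
    obtain ⟨a, ha, b, hb, hab, hnab⟩ := hall
    obtain ⟨z, hz, -, -, hzs⟩ := hG.exists_simplicial_not_adj W a ha ⟨b, hb, hab.symm, hnab⟩
    exact ⟨z, hz, hzs⟩

open Classical in
/-- The neighbours of `v` that precede it in the order given by the rank function `r`. -/
noncomputable def earlier {V : Type*} [Fintype V] (G : SimpleGraph V) (r : V → ℕ) (v : V) :
    Finset V :=
  Finset.univ.filter fun u => G.Adj u v ∧ r u < r v

/-- A perfect elimination ordering, given by an injective rank function: the earlier neighbours of
each vertex form a clique. -/
structure IsPEO {V : Type*} [Fintype V] (G : SimpleGraph V) (r : V → ℕ) : Prop where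
  inj : Function.Injective r
  clique : ∀ v, ∀ a ∈ earlier G r v, ∀ b ∈ earlier G r v, a ≠ b → G.Adj a b

lemma mem_earlier {V : Type*} [Fintype V] {G : SimpleGraph V} {r : V → ℕ} {u v : V} :
    u ∈ earlier G r v ↔ G.Adj u v ∧ r u < r v := by
  simp [earlier]

/-- A chordal graph has a perfect elimination ordering: a simplicial vertex may come last. -/
theorem IsChordal.exists_isPEO {V : Type*} [Fintype V] {G : SimpleGraph V} (hG : IsChordal G) :
    ∃ r, IsPEO G r := by
  classical
  suffices h : ∀ W : Finset V, ∃ r : V → ℕ, Set.InjOn r W ∧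
      ∀ v ∈ W, ∀ a ∈ W, ∀ b ∈ W, G.Adj a v → r a < r v → G.Adj b v → r b < r v →
        a ≠ b → G.Adj a b by
    obtain ⟨r, hr, hcl⟩ := h Finset.univ
    refine ⟨r, fun a b hab => hr (by simp) (by simp) hab, fun v a ha b hb hab => ?_⟩
    rw [mem_earlier] at ha hb
    exact hcl v (by simp) a (by simp) b (by simp) ha.1 ha.2 hb.1 hb.2 hab
  intro W
  induction W using Finset.strongInduction with
  | H W ih =>
  rcases W.eq_empty_or_nonempty with rfl | hW
  · exact ⟨fun _ => 0, by simp, by simp⟩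
  obtain ⟨z, hz, hs⟩ := hG.exists_simplicial hW
  obtain ⟨r, hr, hcl⟩ := ih (W.erase z) (Finset.erase_ssubset hz)
  have hlt : ∀ a ∈ W, a ≠ z → r a < W.sup r + 1 := fun a ha _ =>
    Nat.lt_succ_of_le (Finset.le_sup (f := r) ha)
  refine ⟨fun u => if u = z then W.sup r + 1 else r u, ?_, ?_⟩
  · intro a ha b hb hab
    simp only at hab
    split_ifs at hab with h1 h2 h2
    · rw [h1, h2]
    · exact absurd hab (hlt b hb h2).ne'
    · exact absurd hab (hlt a ha h1).ne
    · exact hr (by simpa [h1] using ha) (by simpa [h2] using hb) hab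
  · intro v hv a ha b hb hav hra hbv hrb hab
    by_cases hvz : v = z
    · subst hvz
      exact hs a ha b hb hav.symm hbv.symm hab
    · simp only [if_neg hvz] at hra hrb
      have hlv := hlt v hv hvz
      have haz : a ≠ z := by
        rintro rfl
        rw [if_pos rfl] at hra
        omega
      have hbz : b ≠ z := by
        rintro rfl
        rw [if_pos rfl] at hrb
        omega
      rw [if_neg haz] at hra
      rw [if_neg hbz] at hrb
      exact hcl v (by simp [hvz, hv]) a (by simp [haz, ha]) b (by simp [hbz, hb]) hav hra hbv hrb hab

/-! ### Components, cliques and induced cycles seen from a perfect elimination ordering -/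

/-- The vertex without earlier neighbours that is reached from `v` by going repeatedly to an
earlier neighbour. -/
noncomputable def root {V : Type*} (G : SimpleGraph V) (r : V → ℕ) (v : V) : V :=
  open Classical in
  if h : ∃ u, G.Adj u v ∧ r u < r v then root G r h.choose else v
termination_by r v
decreasing_by exact h.choose_spec.2

section PEO

variable {V : Type*} [Fintype V] {G : SimpleGraph V} {r : V → ℕ}

lemma root_of_earlier_eq_empty {v : V} (h : earlier G r v = ∅) : root G r v = v := by
  have hn : ¬ ∃ u, G.Adj u v ∧ r u < r v := by
    rintro ⟨u, hu⟩
    rw [← mem_earlier, h] at hu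
    simp at hu
  rw [root, dif_neg hn]

lemma earlier_root_and_reachable (G : SimpleGraph V) (r : V → ℕ) (v : V) :
    earlier G r (root G r v) = ∅ ∧ G.Reachable v (root G r v) := by
  induction hn : r v using Nat.strong_induction_on generalizing v with
  | _ n ih =>
  by_cases h : ∃ u, G.Adj u v ∧ r u < r v
  · rw [root, dif_pos h]
    obtain ⟨h1, h2⟩ := ih _ (hn ▸ h.choose_spec.2) h.choose rfl
    exact ⟨h1, h.choose_spec.1.symm.reachable.trans h2⟩
  · rw [root, dif_neg h]
    refine ⟨Finset.eq_empty_of_forall_notMem fun u hu => h ⟨u, mem_earlier.1 hu⟩, ?_⟩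
    exact SimpleGraph.Reachable.refl _

lemma IsPEO.root_eq_of_adj_of_lt (hr : IsPEO G r) (u v : V) (huv : G.Adj u v) (hlt : r u < r v) :
    root G r u = root G r v := by
  induction hn : r v using Nat.strong_induction_on generalizing u v with
  | _ n ih =>
  have h : ∃ u, G.Adj u v ∧ r u < r v := ⟨u, huv, hlt⟩
  rw [root.eq_def G r v, dif_pos h]
  have hm := h.choose_spec
  by_cases hum : u = h.choose
  · rw [← hum]
  have hadj := hr.clique v u (mem_earlier.2 ⟨huv, hlt⟩) _ (mem_earlier.2 hm) hum
  rcases lt_trichotomy (r u) (r h.choose) with h1 | h1 | h1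
  · exact ih _ (hn ▸ hm.2) u _ hadj h1 rfl
  · exact absurd (hr.inj h1) hum
  · exact (ih _ (hn ▸ hlt) _ u hadj.symm h1 rfl).symm

lemma IsPEO.root_eq_of_reachable (hr : IsPEO G r) {u v : V} (h : G.Reachable u v) :
    root G r u = root G r v := by
  obtain ⟨p⟩ := h
  induction p with
  | nil => rfl
  | @cons a b _ hab _ ih =>
    rw [← ih]
    rcases lt_trichotomy (r a) (r b) with h1 | h1 | h1
    · exact hr.root_eq_of_adj_of_lt a b hab h1
    · exact absurd (hr.inj h1) hab.ne
    · exact (hr.root_eq_of_adj_of_lt b a hab.symm h1).symm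

/-- The components correspond to the vertices without earlier neighbours. -/
lemma IsPEO.cc_eq [DecidableEq V] (hr : IsPEO G r) :
    cc G = (Finset.univ.filter fun v => earlier G r v = ∅).card := by
  have hbij : Function.Bijective
      (fun v : {v // earlier G r v = ∅} => G.connectedComponentMk v.1) := by
    constructor
    · intro v w hvw
      have h := hr.root_eq_of_reachable (SimpleGraph.ConnectedComponent.eq.1 hvw)
      rw [root_of_earlier_eq_empty v.2, root_of_earlier_eq_empty w.2] at h
      exact Subtype.ext h
    · intro c
      induction c using SimpleGraph.ConnectedComponent.ind with
      | h v =>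
        obtain ⟨h1, h2⟩ := earlier_root_and_reachable G r v
        exact ⟨⟨_, h1⟩, SimpleGraph.ConnectedComponent.eq.2 h2.symm⟩
  rw [cc, ← Nat.card_eq_of_bijective _ hbij, Nat.card_eq_fintype_card, Fintype.card_subtype]

lemma notMem_earlier_self (v : V) : v ∉ earlier G r v := fun h => (mem_earlier.1 h).2.false

/-- The last vertex of an induced cycle has two earlier neighbours on it, which are adjacent. -/
lemma IsPEO.isChordal (hr : IsPEO G r) : IsChordal G := by
  intro k hk
  obtain ⟨n, rfl⟩ : ∃ n, k = n + 2 := ⟨k - 2, by omega⟩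
  refine ⟨fun f => ?_⟩
  obtain ⟨i, -, hi⟩ := Finset.exists_max_image Finset.univ (fun i => r (f i)) ⟨0, by simp⟩
  have key : ∀ j, (SimpleGraph.cycleGraph (n + 2)).Adj j i → f j ∈ earlier G r (f i) := by
    intro j hj
    refine mem_earlier.2 ⟨f.map_adj_iff.2 hj, lt_of_le_of_ne (hi j (by simp)) fun h => ?_⟩
    exact hj.ne (f.injective (hr.inj h))
  have main : ∀ a b : Fin (n + 2), a ≠ b → (SimpleGraph.cycleGraph (n + 2)).Adj a i →
      (SimpleGraph.cycleGraph (n + 2)).Adj b i → (SimpleGraph.cycleGraph (n + 2)).Adj a b :=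
    fun a b hab ha hb => f.map_adj_iff.1
      (hr.clique _ _ (key a ha) _ (key b hb) fun h => hab (f.injective h))
  have hi2 := i.2
  obtain ⟨a, ha⟩ : ∃ a : Fin (n + 2), a.val = if i.val = 0 then n + 1 else i.val - 1 :=
    ⟨⟨if i.val = 0 then n + 1 else i.val - 1, by split_ifs <;> omega⟩, rfl⟩
  obtain ⟨b, hb⟩ : ∃ b : Fin (n + 2), b.val = if i.val = n + 1 then 0 else i.val + 1 :=
    ⟨⟨if i.val = n + 1 then 0 else i.val + 1, by split_ifs <;> omega⟩, rfl⟩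
  have h := main a b (by rw [Ne, Fin.ext_iff]; split_ifs at ha hb <;> omega)
    (by rw [cycleGraph_add_two_adj]; split_ifs at ha <;> omega)
    (by rw [cycleGraph_add_two_adj]; split_ifs at hb <;> omega)
  rw [cycleGraph_add_two_adj] at h
  split_ifs at ha hb <;> omega

/-- A clique consists of its last vertex and some earlier neighbours of that vertex. -/
lemma IsPEO.erase_subset_earlier [DecidableEq V] (hr : IsPEO G r) {K : Finset V}
    (hK : G.IsClique (K : Set V)) {v : V} (hv : v ∈ K) (hmax : ∀ u ∈ K, r u ≤ r v) :
    K.erase v ⊆ earlier G r v := by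
  intro u hu
  rw [Finset.mem_erase] at hu
  refine mem_earlier.2 ⟨hK hu.2 hv hu.1, lt_of_le_of_ne (hmax u hu.2) fun h => ?_⟩
  exact hu.1 (hr.inj h)

lemma IsPEO.isClique_insert [DecidableEq V] (hr : IsPEO G r) {v : V} {T : Finset V}
    (hT : T ⊆ earlier G r v) : G.IsClique ((insert v T : Finset V) : Set V) := by
  rw [Finset.coe_insert, SimpleGraph.isClique_insert]
  refine ⟨fun a ha b hb hab => hr.clique v a (hT ha) b (hT hb) hab, fun b hb _ => ?_⟩
  exact (mem_earlier.1 (hT hb)).1.symm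

lemma IsPEO.cliqueNum_le (hr : IsPEO G r) {ω : ℕ} (h : ∀ v, (earlier G r v).card + 1 ≤ ω) :
    G.cliqueNum ≤ ω := by
  classical
  obtain ⟨K, hK⟩ := G.exists_isNClique_cliqueNum
  rw [← hK.card_eq]
  rcases K.eq_empty_or_nonempty with rfl | hne
  · simp
  obtain ⟨v, hv, hmax⟩ := Finset.exists_max_image K r hne
  have h1 := Finset.card_le_card (hr.erase_subset_earlier hK.isClique hv hmax)
  have h2 := h v
  rw [Finset.card_erase_of_mem hv] at h1
  omega

lemma IsPEO.card_earlier_lt (hr : IsPEO G r) (v : V) :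
    (earlier G r v).card + 1 ≤ G.cliqueNum := by
  classical
  rw [← Finset.card_insert_of_notMem (notMem_earlier_self (G := G) (r := r) v)]
  exact SimpleGraph.IsClique.card_le_cliqueNum (tc := hr.isClique_insert subset_rfl)

end PEO

/-! ### Expectations under independent vertex sampling -/

section Sampling

variable {N : ℕ} {p : ℝ}

lemma samplingProb_nonneg (h0 : 0 ≤ p) (h1 : p ≤ 1) (S : Finset (Fin N)) :
    0 ≤ samplingProb p S :=
  Finset.prod_nonneg fun v _ => by split_ifs <;> linarith

/-- The sampling indicators of the vertices are independent. -/
lemma sum_samplingProb_mul_prod (p : ℝ) (g h : Fin N → ℝ) :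
    ∑ S : Finset (Fin N), samplingProb p S * ∏ v, (if v ∈ S then g v else h v) =
      ∏ v, (p * g v + (1 - p) * h v) := by
  rw [Finset.prod_add, Finset.powerset_univ]
  refine Finset.sum_congr rfl fun S _ => ?_
  rw [samplingProb, ← Finset.prod_mul_distrib,
    ← Finset.prod_mul_prod_compl S, ← Finset.compl_eq_univ_sdiff]
  congr 1
  · exact Finset.prod_congr rfl fun v hv => by simp [hv]
  · exact Finset.prod_congr rfl fun v hv => by simp [Finset.mem_compl.1 hv]

lemma sum_samplingProb (p : ℝ) : ∑ S : Finset (Fin N), samplingProb p S = 1 := by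
  simpa using sum_samplingProb_mul_prod (N := N) p (fun _ => 1) (fun _ => 1)

lemma sum_samplingProb_subset (p : ℝ) (A : Finset (Fin N)) :
    ∑ S : Finset (Fin N), samplingProb p S * (if A ⊆ S then 1 else 0) = p ^ A.card := by
  have h := sum_samplingProb_mul_prod p (fun _ => 1) (fun v => if v ∈ A then 0 else 1)
  have h2 : ∏ v, (p * 1 + (1 - p) * (if v ∈ A then 0 else 1)) = p ^ A.card := by
    rw [← Finset.prod_mul_prod_compl A,
      Finset.prod_congr rfl (g := fun _ => p) (fun v hv => by simp [hv]),
      Finset.prod_congr rfl (s₁ := Aᶜ) (g := fun _ => 1)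
        (fun v hv => by simp [Finset.mem_compl.1 hv])]
    simp
  rw [← h2, ← h]
  refine Finset.sum_congr rfl fun S _ => ?_
  congr 1
  split_ifs with hA
  · refine (Finset.prod_eq_one fun v _ => ?_).symm
    by_cases hv : v ∈ S
    · simp [hv]
    · have hvA : v ∉ A := fun h => hv (hA h)
      simp [hv, hvA]
  · obtain ⟨v, hvA, hvS⟩ := Finset.not_subset.1 hA
    exact (Finset.prod_eq_zero (Finset.mem_univ v) (by simp [hvA, hvS])).symm

/-- The centred and rescaled sampling indicator `1 - 𝟙[v ∈ S] / p`, of mean `0` and variance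
`(1 - p) / p`. -/
noncomputable def noise (p : ℝ) (S : Finset (Fin N)) (v : Fin N) : ℝ :=
  1 - (if v ∈ S then 1 else 0) / p

/-- The products of the variables `noise p S v` over sets of vertices are orthogonal. -/
lemma sum_samplingProb_noise (hp : p ≠ 0) (A B : Finset (Fin N)) :
    ∑ S : Finset (Fin N),
        samplingProb p S * ((∏ v ∈ A, noise p S v) * ∏ v ∈ B, noise p S v) =
      if A = B then ((1 - p) / p) ^ A.card else 0 := by
  let g : Fin N → ℝ := fun v =>
    (if v ∈ A then 1 - 1 / p else 1) * (if v ∈ B then 1 - 1 / p else 1)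
  have hS : ∀ S : Finset (Fin N), (∏ v ∈ A, noise p S v) * ∏ v ∈ B, noise p S v =
      ∏ v, (if v ∈ S then g v else 1) := by
    intro S
    rw [← Fintype.prod_ite_mem A, ← Fintype.prod_ite_mem B, ← Finset.prod_mul_distrib]
    refine Finset.prod_congr rfl fun v _ => ?_
    by_cases hv : v ∈ S <;> simp [noise, g, hv]
  simp_rw [hS]
  rw [sum_samplingProb_mul_prod]
  split_ifs with hAB
  · subst hAB
    rw [← Finset.prod_mul_prod_compl A,
      Finset.prod_congr rfl (g := fun _ => (1 - p) / p) (fun v hv => by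
        simp only [g, hv, if_true]
        field_simp
        ring),
      Finset.prod_congr rfl (s₁ := Aᶜ) (g := fun _ => 1)
        (fun v hv => by simp [g, Finset.mem_compl.1 hv])]
    simp [div_pow]
  · obtain ⟨v, hv⟩ : ∃ v, ¬ (v ∈ A ↔ v ∈ B) := by
      by_contra hcon
      push Not at hcon
      exact hAB (Finset.ext hcon)
    refine Finset.prod_eq_zero (Finset.mem_univ v) ?_
    by_cases hA : v ∈ A <;> by_cases hB : v ∈ B
    · exact absurd (iff_of_true hA hB) hv
    · simp only [g, hA, hB, if_true, if_false]
      field_simp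
      ring
    · simp only [g, hA, hB, if_true, if_false]
      field_simp
      ring
    · exact absurd (iff_of_false hA hB) hv

end Sampling

/-! ### The clique-counting estimator and the upper bounds -/

open Classical in
/-- The inverse-probability weighted alternating clique count `∑ K, (-1) ^ (|K| + 1) / p ^ |K|`
over the nonempty cliques `K` of the observed graph. -/
noncomputable def cliqueEstimator (N : ℕ) (p : ℝ) : Estimator N := fun S H =>
  ∑ K : Finset (Fin N) with K.Nonempty ∧ K ⊆ S ∧ ∀ a (ha : a ∈ S) b (hb : b ∈ S),
    a ∈ K → b ∈ K → a ≠ b → H.Adj ⟨a, Finset.mem_coe.2 ha⟩ ⟨b, Finset.mem_coe.2 hb⟩,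
    -(-1 / p) ^ K.card

section Upper

variable {N : ℕ} {p : ℝ} {G : SimpleGraph (Fin N)} {r : Fin N → ℕ}

/-- Summing over nonempty cliques is summing over their last vertex and the set of the others. -/
lemma IsPEO.sum_cliques (hr : IsPEO G r) (f : Finset (Fin N) → ℝ) :
    open Classical in
    ∑ K ∈ Finset.univ.filter
        (fun K : Finset (Fin N) => K.Nonempty ∧ G.IsClique (K : Set (Fin N))), f K =
      ∑ v, ∑ T ∈ (earlier G r v).powerset, f (insert v T) := by
  classical
  rw [Finset.sum_sigma']
  symm
  refine Finset.sum_bij (fun x _ => insert x.1 x.2) ?_ ?_ ?_ (fun _ _ => rfl)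
  · rintro ⟨v, T⟩ hx
    simp only [Finset.mem_sigma, Finset.mem_univ, Finset.mem_powerset, true_and] at hx
    exact Finset.mem_filter.2 ⟨Finset.mem_univ _, Finset.insert_nonempty _ _,
      hr.isClique_insert hx⟩
  · rintro ⟨v, T⟩ hx ⟨w, T'⟩ hy heq
    simp only [Finset.mem_sigma, Finset.mem_univ, Finset.mem_powerset, true_and] at hx hy heq
    have hvw : v = w := by
      by_contra hne
      have h1 : v ∈ T' := by
        have : v ∈ insert w T' := heq ▸ Finset.mem_insert_self v T
        exact (Finset.mem_insert.1 this).resolve_left hne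
      have h2 : w ∈ T := by
        have : w ∈ insert v T := heq ▸ Finset.mem_insert_self w T'
        exact (Finset.mem_insert.1 this).resolve_left (Ne.symm hne)
      have h3 := (mem_earlier.1 (hx h2)).2
      have h4 := (mem_earlier.1 (hy h1)).2
      omega
    subst hvw
    have hT : v ∉ T := fun h => notMem_earlier_self v (hx h)
    have hT' : v ∉ T' := fun h => notMem_earlier_self v (hy h)
    rw [← Finset.erase_insert hT, heq, Finset.erase_insert hT']
  · intro K hK
    obtain ⟨-, hne, hcl⟩ := Finset.mem_filter.1 hK
    obtain ⟨v, hv, hmax⟩ := Finset.exists_max_image K r hne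
    refine ⟨⟨v, K.erase v⟩, ?_, Finset.insert_erase hv⟩
    simp only [Finset.mem_sigma, Finset.mem_univ, Finset.mem_powerset, true_and]
    exact hr.erase_subset_earlier hcl hv hmax

/-- In terms of a perfect elimination ordering, the estimator telescopes over the vertices. -/
lemma IsPEO.cliqueEstimator_eq (hr : IsPEO G r) (S : Finset (Fin N)) :
    cliqueEstimator N p S (G.induce (S : Set (Fin N))) =
      ∑ v, (∏ u ∈ earlier G r v, noise p S u -
        ∏ u ∈ insert v (earlier G r v), noise p S u) := by
  classical
  have hv : ∀ v, ∏ u ∈ earlier G r v, noise p S u -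
      ∏ u ∈ insert v (earlier G r v), noise p S u =
      ∑ T ∈ (earlier G r v).powerset, -∏ u ∈ insert v T, (noise p S u - 1) := by
    intro v
    have h1 : ∏ u ∈ earlier G r v, noise p S u =
        ∑ T ∈ (earlier G r v).powerset, ∏ u ∈ T, (noise p S u - 1) := by
      rw [← Finset.prod_add_one]
      simp
    have h2 : ∀ T ∈ (earlier G r v).powerset, -∏ u ∈ insert v T, (noise p S u - 1) =
        (1 - noise p S v) * ∏ u ∈ T, (noise p S u - 1) := by
      intro T hT
      rw [Finset.prod_insert
        fun h => notMem_earlier_self v (Finset.mem_powerset.1 hT h)]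
      ring
    rw [Finset.sum_congr rfl h2, ← Finset.mul_sum, ← h1,
      Finset.prod_insert (notMem_earlier_self v)]
    ring
  simp_rw [hv]
  rw [← hr.sum_cliques fun K => -∏ u ∈ K, (noise p S u - 1), cliqueEstimator]
  rw [Finset.sum_filter, Finset.sum_filter]
  refine Finset.sum_congr rfl fun K _ => ?_
  by_cases hKS : K ⊆ S
  · have hprod : ∏ u ∈ K, (noise p S u - 1) = (-1 / p) ^ K.card := by
      rw [Finset.prod_congr rfl (g := fun _ => -1 / p)
        (fun u hu => by simp only [noise, hKS hu, if_true]; ring)]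
      simp [div_pow]
    rw [hprod]
    refine if_congr (and_congr_right fun _ => ?_) rfl rfl
    constructor
    · rintro ⟨-, h⟩ a ha b hb hab
      exact h a (hKS ha) b (hKS hb) ha hb hab
    · intro h
      exact ⟨hKS, fun a _ b _ ha hb hab => h ha hb hab⟩
  · obtain ⟨u, huK, huS⟩ := Finset.not_subset.1 hKS
    have hprod : ∏ u ∈ K, (noise p S u - 1) = 0 :=
      Finset.prod_eq_zero huK (by simp [noise, huS])
    rw [hprod]
    simp [hKS]

lemma sum_samplingProb_mul_sq (hp : p ≠ 0) (s : Finset (Finset (Fin N)))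
    (c : Finset (Fin N) → ℝ) :
    ∑ S : Finset (Fin N), samplingProb p S * (∑ A ∈ s, c A * ∏ v ∈ A, noise p S v) ^ 2 =
      ∑ A ∈ s, c A ^ 2 * ((1 - p) / p) ^ A.card := by
  have h : ∀ S : Finset (Fin N),
      samplingProb p S * (∑ A ∈ s, c A * ∏ v ∈ A, noise p S v) ^ 2 =
      ∑ A ∈ s, ∑ B ∈ s, c A * c B * (samplingProb p S *
        ((∏ v ∈ A, noise p S v) * ∏ v ∈ B, noise p S v)) := by
    intro S
    rw [sq, Finset.sum_mul_sum, Finset.mul_sum]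
    refine Finset.sum_congr rfl fun A _ => ?_
    rw [Finset.mul_sum]
    exact Finset.sum_congr rfl fun B _ => by ring
  simp_rw [h]
  rw [Finset.sum_comm]
  refine Finset.sum_congr rfl fun A hA => ?_
  rw [Finset.sum_comm]
  simp_rw [← Finset.mul_sum, sum_samplingProb_noise hp]
  rw [Finset.sum_eq_single A]
  · simp [sq]
  · intro B _ hBA
    simp [hBA.symm]
  · exact fun h => absurd hA h

/-- The mean squared error of the clique estimator. A nonempty set `A` is the set of earlier
neighbours of at most `d` vertices, and has at most one last vertex. -/
lemma IsPEO.mse_cliqueEstimator_le (hr : IsPEO G r) (h0 : 0 < p) (h1 : p ≤ 1) {d : ℕ}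
    (hd : open Classical in G.maxDegree ≤ d) :
    mse p (cliqueEstimator N p) G ≤
      ∑ v, (d * (if earlier G r v = ∅ then 0 else ((1 - p) / p) ^ (earlier G r v).card) +
        ((1 - p) / p) ^ ((earlier G r v).card + 1)) := by
  classical
  let n : Finset (Fin N) → ℝ := fun A => ∑ v, if earlier G r v = A then 1 else 0
  let m : Finset (Fin N) → ℝ := fun A =>
    ∑ v, if insert v (earlier G r v) = A then 1 else 0
  have hlam : 0 ≤ (1 - p) / p := div_nonneg (by linarith) h0.le
  have hexp : ∀ S : Finset (Fin N),
      cliqueEstimator N p S (G.induce (S : Set (Fin N))) - (cc G : ℝ) =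
      ∑ A ∈ Finset.univ.erase ∅, (n A - m A) * ∏ v ∈ A, noise p S v := by
    intro S
    have hall : cliqueEstimator N p S (G.induce (S : Set (Fin N))) =
        ∑ A, (n A - m A) * ∏ v ∈ A, noise p S v := by
      rw [hr.cliqueEstimator_eq]
      simp only [n, m, ← Finset.sum_sub_distrib, Finset.sum_mul]
      rw [Finset.sum_comm]
      refine Finset.sum_congr rfl fun v _ => ?_
      simp [sub_mul, Finset.sum_sub_distrib]
    have hempty : n ∅ - m ∅ = cc G := by
      simp [n, m, hr.cc_eq]
    rw [hall, ← Finset.add_sum_erase _ _ (Finset.mem_univ ∅), hempty]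
    simp
  have hm0 : ∀ A, 0 ≤ m A := fun A => Finset.sum_nonneg fun v _ => by split_ifs <;> simp
  have hn0 : ∀ A, 0 ≤ n A := fun A => Finset.sum_nonneg fun v _ => by split_ifs <;> simp
  have hm1 : ∀ A, m A ≤ 1 := by
    intro A
    simp only [m, Finset.sum_boole]
    norm_cast
    rw [Finset.card_le_one]
    intro a ha b hb
    have ha' := (Finset.mem_filter.1 ha).2
    have hb' := (Finset.mem_filter.1 hb).2
    by_contra hab
    have h2 : b ∈ insert a (earlier G r a) := by
      rw [ha', ← hb']
      exact Finset.mem_insert_self _ _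
    have h3 : a ∈ insert b (earlier G r b) := by
      rw [hb', ← ha']
      exact Finset.mem_insert_self _ _
    have h4 := (mem_earlier.1 ((Finset.mem_insert.1 h2).resolve_left (Ne.symm hab))).2
    have h5 := (mem_earlier.1 ((Finset.mem_insert.1 h3).resolve_left hab)).2
    omega
  have hnd : ∀ A, A ≠ ∅ → n A ≤ d := by
    intro A hA
    obtain ⟨a, ha⟩ := Finset.nonempty_iff_ne_empty.2 hA
    simp only [n, Finset.sum_boole]
    norm_cast
    refine le_trans (le_trans (Finset.card_le_card ?_) (G.degree_le_maxDegree a)) hd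
    intro v hv
    rw [SimpleGraph.mem_neighborFinset]
    have hv' := (Finset.mem_filter.1 hv).2
    rw [← hv'] at ha
    exact (mem_earlier.1 ha).1
  rw [mse]
  simp_rw [hexp]
  rw [sum_samplingProb_mul_sq h0.ne']
  calc ∑ A ∈ Finset.univ.erase ∅, (n A - m A) ^ 2 * ((1 - p) / p) ^ A.card
      ≤ ∑ A ∈ Finset.univ.erase ∅, (d * n A + m A) * ((1 - p) / p) ^ A.card := by
        refine Finset.sum_le_sum fun A hA => mul_le_mul_of_nonneg_right ?_ (pow_nonneg hlam _)
        have h2 := hnd A (Finset.ne_of_mem_erase hA)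
        have h3 := hn0 A
        have h4 := hm0 A
        have h5 := hm1 A
        nlinarith [mul_nonneg h3 h4, mul_nonneg h3 (sub_nonneg.2 h2),
          mul_nonneg h4 (sub_nonneg.2 h5)]
    _ ≤ ∑ A, (d * (if A = ∅ then 0 else n A) + m A) * ((1 - p) / p) ^ A.card := by
        rw [← Finset.add_sum_erase _ _ (Finset.mem_univ ∅)]
        refine le_add_of_nonneg_of_le ?_ (Finset.sum_le_sum fun A hA => ?_)
        · simp [hm0]
        · rw [if_neg (Finset.ne_of_mem_erase hA)]
    _ = _ := by
        have hsplit : ∀ A : Finset (Fin N),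
            (d * (if A = ∅ then 0 else n A) + m A) * ((1 - p) / p) ^ A.card =
            ∑ v, ((if earlier G r v = A then
                (d * (if A = ∅ then 0 else ((1 - p) / p) ^ A.card)) else 0) +
              (if insert v (earlier G r v) = A then ((1 - p) / p) ^ A.card else 0)) := by
          intro A
          rw [Finset.sum_add_distrib, add_mul]
          congr 1
          · by_cases hA : A = ∅
            · simp [hA]
            · simp only [hA, if_false, n]
              rw [Finset.mul_sum, Finset.sum_mul]
              refine Finset.sum_congr rfl fun v _ => ?_
              split_ifs <;> simp
          · simp only [m]
            rw [Finset.sum_mul]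
            refine Finset.sum_congr rfl fun v _ => ?_
            split_ifs <;> simp
        simp_rw [hsplit]
        rw [Finset.sum_comm]
        refine Finset.sum_congr rfl fun v _ => ?_
        rw [Finset.sum_add_distrib, Finset.sum_ite_eq, Finset.sum_ite_eq]
        simp [Finset.card_insert_of_notMem (notMem_earlier_self (G := G) (r := r) v)]

lemma mse_nonneg (h0 : 0 ≤ p) (h1 : p ≤ 1) (est : Estimator N) (G : SimpleGraph (Fin N)) :
    0 ≤ mse p est G :=
  Finset.sum_nonneg fun S _ => mul_nonneg (samplingProb_nonneg h0 h1 S) (sq_nonneg _)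

lemma minimaxRisk_le {d ω : ℕ} (h0 : 0 ≤ p) (h1 : p ≤ 1) (est : Estimator N) {b : ℝ}
    (hb : 0 ≤ b) (h : ∀ G ∈ chordalClass N d ω, mse p est G ≤ b) :
    minimaxRisk N d ω p ≤ b := by
  refine le_trans (ciInf_le ⟨0, ?_⟩ est) (Real.iSup_le (fun G => h G G.2) hb)
  rintro _ ⟨e, rfl⟩
  exact Real.iSup_nonneg fun G => mse_nonneg h0 h1 e G

lemma cc_le (G : SimpleGraph (Fin N)) : cc G ≤ N := by
  have h := Nat.card_le_card_of_surjective G.connectedComponentMk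
    (fun c => c.ind fun v => ⟨v, rfl⟩)
  simpa [cc] using h

lemma minimaxRisk_le_sq {d ω : ℕ} (h0 : 0 ≤ p) (h1 : p ≤ 1) :
    minimaxRisk N d ω p ≤ (N : ℝ) ^ 2 := by
  refine minimaxRisk_le h0 h1 (fun _ _ => 0) (sq_nonneg _) fun G _ => ?_
  have h : (cc G : ℝ) ≤ N := by exact_mod_cast cc_le G
  rw [mse, ← Finset.sum_mul, sum_samplingProb, one_mul, zero_sub, neg_sq]
  gcongr

lemma minimaxRisk_le_of_half_le {d ω : ℕ} (h0 : 1 / 2 ≤ p) (h1 : p ≤ 1) :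
    minimaxRisk N d ω p ≤ (N : ℝ) * ((1 - p) / p) * ((d : ℝ) + 1) := by
  have hp : 0 < p := by linarith
  have hlam : 0 ≤ (1 - p) / p := div_nonneg (by linarith) hp.le
  have hlam1 : (1 - p) / p ≤ 1 := by
    rw [div_le_one hp]
    linarith
  refine minimaxRisk_le hp.le h1 (cliqueEstimator N p) (by positivity) fun G hG => ?_
  obtain ⟨r, hr⟩ := hG.1.exists_isPEO
  refine (hr.mse_cliqueEstimator_le hp h1 hG.2.1).trans ?_
  have hv : ∀ v ∈ Finset.univ,
      d * (if earlier G r v = ∅ then 0 else ((1 - p) / p) ^ (earlier G r v).card) +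
        ((1 - p) / p) ^ ((earlier G r v).card + 1) ≤ (1 - p) / p * (d + 1) := by
    intro v _
    have ha : (if earlier G r v = ∅ then 0 else ((1 - p) / p) ^ (earlier G r v).card) ≤
        (1 - p) / p := by
      split_ifs with h
      · exact hlam
      · exact pow_le_of_le_one hlam hlam1 (Finset.card_ne_zero.2
          (Finset.nonempty_iff_ne_empty.2 h))
    have hb : ((1 - p) / p) ^ ((earlier G r v).card + 1) ≤ (1 - p) / p :=
      pow_le_of_le_one hlam hlam1 (Nat.succ_ne_zero _)
    have hd : (0 : ℝ) ≤ d := Nat.cast_nonneg d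
    nlinarith [mul_le_mul_of_nonneg_left ha hd]
  refine (Finset.sum_le_sum hv).trans (le_of_eq ?_)
  simp [mul_assoc]

lemma minimaxRisk_le_add {d ω : ℕ} (h0 : 0 < p) (h1 : p ≤ 1) :
    minimaxRisk N d ω p ≤ (N : ℝ) / p ^ ω + (N : ℝ) * d / p ^ (ω - 1) := by
  have hlam : 0 ≤ (1 - p) / p := div_nonneg (by linarith) h0.le
  have hlam1 : (1 - p) / p ≤ 1 / p := by
    gcongr
    linarith
  have hone : 1 ≤ 1 / p := by
    rw [le_div_iff₀ h0]
    linarith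
  have hpow : ∀ i j : ℕ, i ≤ j → ((1 - p) / p) ^ i ≤ 1 / p ^ j := by
    intro i j hij
    rw [← one_div_pow]
    exact (pow_le_pow_left₀ hlam hlam1 i).trans (pow_le_pow_right₀ hone hij)
  refine minimaxRisk_le h0.le h1 (cliqueEstimator N p) (by positivity) fun G hG => ?_
  obtain ⟨r, hr⟩ := hG.1.exists_isPEO
  refine (hr.mse_cliqueEstimator_le h0 h1 hG.2.1).trans ?_
  have hv : ∀ v ∈ Finset.univ,
      d * (if earlier G r v = ∅ then 0 else ((1 - p) / p) ^ (earlier G r v).card) +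
        ((1 - p) / p) ^ ((earlier G r v).card + 1) ≤ d * (1 / p ^ (ω - 1)) + 1 / p ^ ω := by
    intro v _
    have hc := (hr.card_earlier_lt v).trans hG.2.2
    refine add_le_add (mul_le_mul_of_nonneg_left ?_ (Nat.cast_nonneg d)) (hpow _ _ hc)
    split_ifs
    · positivity
    · exact hpow _ _ (by omega)
  refine (Finset.sum_le_sum hv).trans (le_of_eq ?_)
  simp only [Finset.sum_const, Finset.card_univ, Fintype.card_fin, nsmul_eq_mul]
  ring

lemma minimaxRisk_le_rate {d ω : ℕ} (h0 : 0 < p) (h1 : p ≤ 1) :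
    minimaxRisk N d ω p ≤ 2 * rate N d ω p := by
  have ha := minimaxRisk_le_add (N := N) (d := d) (ω := ω) h0 h1
  have hb := minimaxRisk_le_sq (N := N) (d := d) (ω := ω) h0.le h1
  rw [rate, mul_min_of_nonneg _ _ zero_le_two]
  refine le_min ?_ (by linarith [sq_nonneg (N : ℝ)])
  linarith [le_max_left ((N : ℝ) / p ^ ω) ((N : ℝ) * d / p ^ (ω - 1)),
    le_max_right ((N : ℝ) / p ^ ω) ((N : ℝ) * d / p ^ (ω - 1))]

end Upper

/-! ### A minimax lower bound from families of graphs with hidden parities -/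

section Parity

variable {M k : ℕ}

/-- The parity character `(-1) ^ |t|` of a finite set. -/
def parity (t : Finset (Fin k)) : ℝ := (-1) ^ t.card

lemma parity_sq (t : Finset (Fin k)) : parity t ^ 2 = 1 := by
  rw [parity, ← pow_mul, mul_comm, pow_mul]
  simp

lemma sum_parity (hk : 1 ≤ k) : ∑ t : Finset (Fin k), parity t = 0 := by
  have h := Finset.sum_powerset_neg_one_pow_card_of_nonempty (x := (Finset.univ : Finset (Fin k)))
    ⟨⟨0, hk⟩, by simp⟩
  rw [Finset.powerset_univ] at h
  have h2 := congrArg (Int.cast : ℤ → ℝ) h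
  push_cast at h2
  simpa [parity] using h2

lemma parity_symmDiff_singleton (t : Finset (Fin k)) (i : Fin k) :
    parity (symmDiff t {i}) = -parity t := by
  by_cases hi : i ∈ t
  · have h : symmDiff t {i} = t.erase i := by
      ext j
      by_cases hj : j = i <;> simp [Finset.mem_symmDiff, hj, hi]
    rw [h, parity, parity, ← Finset.card_erase_add_one hi, pow_succ]
    ring
  · have h : symmDiff t {i} = insert i t := by
      ext j
      by_cases hj : j = i <;> simp [Finset.mem_symmDiff, hj, hi]
    rw [h, parity, parity, Finset.card_insert_of_notMem hi, pow_succ]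
    ring

/-- The average over all families of `M` subsets of `Fin k`. -/
noncomputable def avg (F : (Fin M → Finset (Fin k)) → ℝ) : ℝ :=
  ((2 : ℝ) ^ k)⁻¹ ^ M * ∑ T, F T

lemma avg_prod (g : Fin M → Finset (Fin k) → ℝ) :
    avg (fun T => ∏ b, g b (T b)) = ∏ b, (((2 : ℝ) ^ k)⁻¹ * ∑ t, g b t) := by
  rw [avg, Finset.prod_mul_distrib, Finset.prod_univ_sum, Fintype.piFinset_univ]
  simp

/-- The density of the law under which the sets `T b` are independent and have density
`1 + θ b * parity` with respect to the uniform law. -/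
def parityDensity (θ : Fin M → ℝ) (T : Fin M → Finset (Fin k)) : ℝ :=
  ∏ b, (1 + θ b * parity (T b))

lemma mean_density (hk : 1 ≤ k) (x : ℝ) :
    ((2 : ℝ) ^ k)⁻¹ * ∑ t : Finset (Fin k), (1 + x * parity t) = 1 := by
  rw [Finset.sum_add_distrib, ← Finset.mul_sum, sum_parity hk]
  simp

lemma avg_parityDensity (hk : 1 ≤ k) (θ : Fin M → ℝ) :
    avg (parityDensity (k := k) θ) = 1 := by
  unfold parityDensity
  rw [avg_prod fun b t => 1 + θ b * parity t]
  exact Finset.prod_eq_one fun b _ => mean_density hk _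

lemma avg_parityDensity_sq (hk : 1 ≤ k) (θ : Fin M → ℝ) :
    avg (fun T : Fin M → Finset (Fin k) => parityDensity θ T ^ 2) = ∏ b, (1 + θ b ^ 2) := by
  unfold parityDensity
  simp_rw [← Finset.prod_pow]
  rw [avg_prod fun b t => (1 + θ b * parity t) ^ 2]
  refine Finset.prod_congr rfl fun b _ => ?_
  have h : ∀ t : Finset (Fin k), (1 + θ b * parity t) ^ 2 =
      (1 + θ b ^ 2) + 2 * θ b * parity t := by
    intro t
    linear_combination θ b ^ 2 * parity_sq t
  simp_rw [h]
  rw [Finset.sum_add_distrib, ← Finset.mul_sum, sum_parity hk]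
  simp only [Finset.sum_const, Finset.card_univ, Fintype.card_finset, Fintype.card_fin,
    nsmul_eq_mul, mul_zero, add_zero]
  push_cast
  rw [inv_mul_cancel_left₀ (by positivity)]

lemma avg_indicator_mul_parityDensity (hk : 1 ≤ k) (θ : Fin M → ℝ) (b₀ : Fin M) :
    avg (fun T : Fin M → Finset (Fin k) => (if T b₀ = ∅ then 1 else 0) * parityDensity θ T) =
      ((2 : ℝ) ^ k)⁻¹ * (1 + θ b₀) := by
  have h : ∀ T : Fin M → Finset (Fin k),
      (if T b₀ = ∅ then 1 else 0) * parityDensity θ T =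
      ∏ b, ((if b = b₀ then (if T b = ∅ then 1 else 0) else 1) * (1 + θ b * parity (T b))) := by
    intro T
    rw [parityDensity, Finset.prod_mul_distrib, Finset.prod_ite_eq']
    simp
  simp_rw [h]
  rw [avg_prod fun b t => (if b = b₀ then (if t = ∅ then 1 else 0) else 1) *
    (1 + θ b * parity t), Finset.prod_eq_single b₀]
  · simp [parity]
  · intro b _ hb
    simp only [hb, if_false, one_mul]
    exact mean_density hk _
  · simp

/-- `T` with the membership of `i` in `T b` switched. -/
def toggle (T : Fin M → Finset (Fin k)) (b : Fin M) (i : Fin k) : Fin M → Finset (Fin k) :=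
  Function.update T b (symmDiff (T b) {i})

lemma toggle_involutive (b : Fin M) (i : Fin k) :
    Function.Involutive fun T : Fin M → Finset (Fin k) => toggle T b i := by
  intro T
  simp [toggle]

/-- A function that does not see the parity of `T b` for the `b` outside `I` cannot tell a bias of
these parities: in the expansion of the density over sets `B` of indices, only those contained in
`I` contribute. -/
lemma sum_mul_parityDensity_eq (f : (Fin M → Finset (Fin k)) → ℝ) (I : Fin M → Prop)
    [DecidablePred I] (hf : ∀ b, ¬ I b → ∃ i, ∀ T, f (toggle T b i) = f T) (δ : ℝ) :
    ∑ T, f T * parityDensity (fun _ => δ) T =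
      ∑ T, f T * parityDensity (fun b => if I b then δ else 0) T := by
  simp only [parityDensity, Finset.prod_one_add, Finset.mul_sum]
  rw [Finset.sum_comm, Finset.sum_comm (s := Finset.univ)]
  refine Finset.sum_congr rfl fun B _ => ?_
  by_cases hB : ∀ b ∈ B, I b
  · refine Finset.sum_congr rfl fun T _ => ?_
    congr 1
    exact Finset.prod_congr rfl fun b hb => by rw [if_pos (hB b hb)]
  · push Not at hB
    obtain ⟨b, hb, hI⟩ := hB
    obtain ⟨i, hi⟩ := hf b hI
    have hR : ∀ T : Fin M → Finset (Fin k),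
        f T * ∏ b ∈ B, (if I b then δ else 0) * parity (T b) = 0 := by
      intro T
      rw [Finset.prod_eq_zero hb (by simp [hI]), mul_zero]
    rw [Finset.sum_congr rfl fun T _ => hR T, Finset.sum_const_zero]
    have hneg : ∀ T : Fin M → Finset (Fin k),
        f (toggle T b i) * ∏ c ∈ B, δ * parity (toggle T b i c) =
        -(f T * ∏ c ∈ B, δ * parity (T c)) := by
      intro T
      rw [hi, ← Finset.mul_prod_erase B _ hb, ← Finset.mul_prod_erase B _ hb,
        Finset.prod_congr rfl (s₁ := B.erase b) (g := fun c => δ * parity (T c))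
          fun c hc => by rw [toggle, Function.update_of_ne (Finset.ne_of_mem_erase hc)]]
      rw [toggle, Function.update_self, parity_symmDiff_singleton]
      ring
    have hsum := Equiv.sum_comp (toggle_involutive (k := k) b i).toPerm
      fun T => f T * ∏ c ∈ B, δ * parity (T c)
    simp only [Function.Involutive.coe_toPerm, hneg, Finset.sum_neg_distrib] at hsum
    linarith

/-- The expected second moment of the likelihood ratio: the number of sets `A b` that are sampled
entirely is binomial. -/
lemma sum_samplingProb_prod_subset {N : ℕ} (p : ℝ) {A : Fin M → Finset (Fin N)} {a : ℕ}
    (hdisj : ∀ b c, b ≠ c → Disjoint (A b) (A c)) (hcard : ∀ b, (A b).card = a) (x : ℝ) :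
    ∑ S : Finset (Fin N), samplingProb p S * ∏ b, (1 + if A b ⊆ S then x else 0) =
      (1 + x * p ^ a) ^ M := by
  have hM : (1 + x * p ^ a) ^ M = ∏ _b : Fin M, (1 + x * p ^ a) := by simp
  rw [hM]
  simp only [Finset.prod_one_add, Finset.mul_sum]
  rw [Finset.sum_comm]
  refine Finset.sum_congr rfl fun B _ => ?_
  have h : ∀ S : Finset (Fin N), samplingProb p S * ∏ b ∈ B, (if A b ⊆ S then x else 0) =
      x ^ B.card * (samplingProb p S * (if B.biUnion A ⊆ S then 1 else 0)) := by
    intro S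
    rw [Finset.prod_ite_zero]
    simp only [Finset.biUnion_subset, Finset.prod_const]
    split_ifs <;> ring
  rw [Finset.sum_congr rfl fun S _ => h S, ← Finset.mul_sum, sum_samplingProb_subset,
    Finset.card_biUnion fun b _ c _ hbc => hdisj b c hbc,
    Finset.sum_congr rfl fun b _ => hcard b, Finset.sum_const, smul_eq_mul, mul_comm B.card,
    pow_mul, Finset.prod_const, mul_pow]

/-- A family of graphs on `Fin N`, indexed by `M` subsets of `Fin k`, whose number of components
is an affine function of the number of empty ones, with slope `ℓ`, while the parity of the `b`-th
subset is hidden unless all of the `a` vertices of `A b` are sampled. -/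
structure HiddenParity (N M k ℓ a : ℕ) where
  /-- The graphs. -/
  graph : (Fin M → Finset (Fin k)) → SimpleGraph (Fin N)
  /-- The vertex set whose observation is needed to determine the `b`-th parity. -/
  A : Fin M → Finset (Fin N)
  disjoint : ∀ b c, b ≠ c → Disjoint (A b) (A c)
  card_A : ∀ b, (A b).card = a
  hidden : ∀ (S : Finset (Fin N)) (b : Fin M), ¬ A b ⊆ S → ∃ i, ∀ T,
    (graph (toggle T b i)).induce (S : Set (Fin N)) = (graph T).induce (S : Set (Fin N))
  /-- The number of components when none of the subsets is empty. -/
  base : ℝ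
  cc_graph : ∀ T, (cc (graph T) : ℝ) = base + ℓ * ∑ b, if T b = ∅ then 1 else 0

/-- The uniform law on the family is compared with the law of density
`W = ∏ b, (1 + δ * parity (T b))`. Given the sampled set, the observation has under the latter law
the likelihood ratio `L`, which is the product over the `b` with `A b` sampled. The error is tested
against `W - L`, which is orthogonal to every function of the observation. -/
lemma HiddenParity.le_of_mse_le {N ℓ a : ℕ} (F : HiddenParity N M k ℓ a) (hk : 1 ≤ k) {p : ℝ}
    (h0 : 0 ≤ p) (h1 : p ≤ 1) {δ : ℝ} (hδ0 : 0 ≤ δ) (hδ1 : δ ≤ 1) (est : Estimator N) {R : ℝ}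
    (hR : ∀ T, mse p est (F.graph T) ≤ R) :
    (ℓ * M * ((2 : ℝ) ^ k)⁻¹ * δ * (1 - p ^ a)) ^ 2 ≤
      2 * (R + R * (1 + δ ^ 2 * p ^ a) ^ M) := by
  let u : ℝ := ((2 : ℝ) ^ k)⁻¹ ^ M
  have hu : 0 ≤ u := by positivity
  let θ : Finset (Fin N) → Fin M → ℝ := fun S b => if F.A b ⊆ S then δ else 0
  let W : (Fin M → Finset (Fin k)) → ℝ := parityDensity fun _ => δ
  let L : Finset (Fin N) → (Fin M → Finset (Fin k)) → ℝ := fun S => parityDensity (θ S)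
  let f : Finset (Fin N) → (Fin M → Finset (Fin k)) → ℝ :=
    fun S T => est S ((F.graph T).induce (S : Set (Fin N)))
  let e : Finset (Fin N) → (Fin M → Finset (Fin k)) → ℝ := fun S T => f S T - cc (F.graph T)
  have hP : ∀ S : Finset (Fin N), 0 ≤ samplingProb p S := samplingProb_nonneg h0 h1
  have hW0 : ∀ T, 0 ≤ W T := by
    intro T
    refine Finset.prod_nonneg fun b _ => ?_
    have hsq := parity_sq (T b)
    have : -1 ≤ parity (T b) := by nlinarith
    nlinarith
  have hWsum : u * ∑ T, W T = 1 := avg_parityDensity hk _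
  have hRnn : 0 ≤ R := (mse_nonneg h0 h1 est _).trans (hR fun _ => ∅)
  -- The test function is orthogonal to the estimator.
  have horth : ∀ S, ∑ T, f S T * W T = ∑ T, f S T * L S T := by
    intro S
    refine sum_mul_parityDensity_eq (f S) (fun b => F.A b ⊆ S) (fun b hb => ?_) δ
    obtain ⟨i, hi⟩ := F.hidden S b hb
    exact ⟨i, fun T => by simp only [f, hi T]⟩
  have hcc : ∀ φ : Fin M → ℝ, u * ∑ T, (cc (F.graph T) : ℝ) * parityDensity φ T =
      F.base + ℓ * ((2 : ℝ) ^ k)⁻¹ * ∑ b, (1 + φ b) := by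
    intro φ
    have h : ∀ T, (cc (F.graph T) : ℝ) * parityDensity φ T = F.base * parityDensity φ T +
        ∑ b, ℓ * ((if T b = ∅ then 1 else 0) * parityDensity φ T) := by
      intro T
      rw [F.cc_graph, add_mul, mul_assoc, Finset.sum_mul, Finset.mul_sum]
    simp_rw [h]
    rw [Finset.sum_add_distrib, Finset.sum_comm]
    simp_rw [← Finset.mul_sum]
    have hA := avg_parityDensity hk φ
    have hB := fun b => avg_indicator_mul_parityDensity hk φ b
    simp only [avg] at hA hB
    rw [mul_add, mul_left_comm, show u * ∑ T, parityDensity φ T = 1 from hA, mul_one,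
      mul_left_comm, Finset.mul_sum Finset.univ _ u, Finset.sum_congr rfl fun b _ => hB b,
      ← Finset.mul_sum]
    ring
  have hX : ∑ S, samplingProb p S * (u * ∑ T, e S T * (W T - L S T)) =
      -(ℓ * M * ((2 : ℝ) ^ k)⁻¹ * δ * (1 - p ^ a)) := by
    have hS : ∀ S, u * ∑ T, e S T * (W T - L S T) =
        -(ℓ * ((2 : ℝ) ^ k)⁻¹ * δ) * ∑ b, (1 - if F.A b ⊆ S then 1 else 0) := by
      intro S
      have hsplit : ∑ T, e S T * (W T - L S T) =
          (∑ T, f S T * W T - ∑ T, f S T * L S T) -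
          (∑ T, (cc (F.graph T) : ℝ) * W T - ∑ T, (cc (F.graph T) : ℝ) * L S T) := by
        rw [← Finset.sum_sub_distrib, ← Finset.sum_sub_distrib, ← Finset.sum_sub_distrib]
        exact Finset.sum_congr rfl fun T _ => by simp only [e]; ring
      rw [hsplit, horth, sub_self, zero_sub, mul_neg, mul_sub, hcc, hcc]
      have hθ : ∑ b, (1 + θ S b) = ∑ _b : Fin M, (1 + δ) -
          δ * ∑ b, (1 - if F.A b ⊆ S then 1 else 0) := by
        rw [Finset.mul_sum, ← Finset.sum_sub_distrib]
        refine Finset.sum_congr rfl fun b _ => ?_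
        simp only [θ]
        split_ifs <;> ring
      rw [hθ]
      ring
    simp_rw [hS, Finset.mul_sum]
    rw [Finset.sum_comm]
    have hb : ∀ b, ∑ S : Finset (Fin N), samplingProb p S *
        (-(ℓ * ((2 : ℝ) ^ k)⁻¹ * δ) * (1 - if F.A b ⊆ S then 1 else 0)) =
        -(ℓ * ((2 : ℝ) ^ k)⁻¹ * δ * (1 - p ^ a)) := by
      intro b
      have h := sum_samplingProb_subset p (F.A b)
      rw [F.card_A] at h
      rw [← h, ← sum_samplingProb (N := N) p, ← Finset.sum_sub_distrib, Finset.mul_sum,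
        ← Finset.sum_neg_distrib]
      exact Finset.sum_congr rfl fun S _ => by rw [sum_samplingProb]; ring
    rw [Finset.sum_congr rfl fun b _ => hb b]
    simp only [Finset.sum_const, Finset.card_univ, Fintype.card_fin, nsmul_eq_mul]
    ring
  have hmse : ∀ T, ∑ S, samplingProb p S * e S T ^ 2 ≤ R := fun T => hR T
  -- Cauchy–Schwarz for the two parts of the test function.
  have hCSW : (∑ x : (Fin M → Finset (Fin k)) × Finset (Fin N),
      u * samplingProb p x.2 * e x.2 x.1 * W x.1) ^ 2 ≤ R := by
    refine (Finset.sum_sq_le_sum_mul_sum_of_sq_le_mul Finset.univ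
      (f := fun x => u * samplingProb p x.2 * e x.2 x.1 ^ 2 * W x.1)
      (g := fun x => u * samplingProb p x.2 * W x.1)
      (fun x _ => mul_nonneg (mul_nonneg (mul_nonneg hu (hP _)) (sq_nonneg _)) (hW0 _))
      (fun x _ => mul_nonneg (mul_nonneg hu (hP _)) (hW0 _))
      (fun x _ => le_of_eq (by ring))).trans ?_
    have hg : ∑ x : (Fin M → Finset (Fin k)) × Finset (Fin N),
        u * samplingProb p x.2 * W x.1 = 1 := by
      rw [Fintype.sum_prod_type, ← hWsum, Finset.mul_sum]
      refine Finset.sum_congr rfl fun T _ => ?_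
      simp only
      rw [← Finset.sum_mul, ← Finset.mul_sum, sum_samplingProb, mul_one]
    rw [hg, mul_one, Fintype.sum_prod_type]
    calc ∑ T, ∑ S, u * samplingProb p S * e S T ^ 2 * W T
        = ∑ T, u * W T * ∑ S, samplingProb p S * e S T ^ 2 := by
          refine Finset.sum_congr rfl fun T _ => ?_
          rw [Finset.mul_sum]
          exact Finset.sum_congr rfl fun S _ => by ring
      _ ≤ ∑ T, u * W T * R :=
          Finset.sum_le_sum fun T _ => mul_le_mul_of_nonneg_left (hmse T) (mul_nonneg hu (hW0 T))
      _ = R := by rw [← Finset.sum_mul, ← Finset.mul_sum, hWsum, one_mul]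
  have hCSL : (∑ x : (Fin M → Finset (Fin k)) × Finset (Fin N),
      u * samplingProb p x.2 * e x.2 x.1 * L x.2 x.1) ^ 2 ≤
      R * (1 + δ ^ 2 * p ^ a) ^ M := by
    refine (Finset.sum_sq_le_sum_mul_sum_of_sq_le_mul Finset.univ
      (f := fun x => u * samplingProb p x.2 * e x.2 x.1 ^ 2)
      (g := fun x => u * samplingProb p x.2 * L x.2 x.1 ^ 2)
      (fun x _ => mul_nonneg (mul_nonneg hu (hP _)) (sq_nonneg _))
      (fun x _ => mul_nonneg (mul_nonneg hu (hP _)) (sq_nonneg _))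
      (fun x _ => le_of_eq (by ring))).trans ?_
    have hg : ∑ x : (Fin M → Finset (Fin k)) × Finset (Fin N),
        u * samplingProb p x.2 * L x.2 x.1 ^ 2 = (1 + δ ^ 2 * p ^ a) ^ M := by
      rw [Fintype.sum_prod_type, Finset.sum_comm,
        ← sum_samplingProb_prod_subset p F.disjoint F.card_A]
      refine Finset.sum_congr rfl fun S _ => ?_
      have h := avg_parityDensity_sq hk (θ S)
      rw [avg] at h
      have h2 : ∏ b, (1 + θ S b ^ 2) = ∏ b, (1 + if F.A b ⊆ S then δ ^ 2 else 0) := by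
        refine Finset.prod_congr rfl fun b _ => ?_
        simp only [θ]
        split_ifs <;> simp
      rw [← h2, ← h, Finset.mul_sum, Finset.mul_sum]
      exact Finset.sum_congr rfl fun T _ => by simp only [u, L]; ring
    rw [hg]
    refine mul_le_mul_of_nonneg_right ?_ (by positivity)
    rw [Fintype.sum_prod_type]
    calc ∑ T, ∑ S, u * samplingProb p S * e S T ^ 2
        = ∑ T, u * ∑ S, samplingProb p S * e S T ^ 2 := by
          refine Finset.sum_congr rfl fun T _ => ?_
          rw [Finset.mul_sum]
          exact Finset.sum_congr rfl fun S _ => by ring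
      _ ≤ ∑ _T : Fin M → Finset (Fin k), u * R :=
          Finset.sum_le_sum fun T _ => mul_le_mul_of_nonneg_left (hmse T) hu
      _ = R := by
          simp [u]
  have hXsplit : ∑ S, samplingProb p S * (u * ∑ T, e S T * (W T - L S T)) =
      (∑ x : (Fin M → Finset (Fin k)) × Finset (Fin N),
        u * samplingProb p x.2 * e x.2 x.1 * W x.1) -
      ∑ x : (Fin M → Finset (Fin k)) × Finset (Fin N),
        u * samplingProb p x.2 * e x.2 x.1 * L x.2 x.1 := by
    rw [← Finset.sum_sub_distrib, Fintype.sum_prod_type, Finset.sum_comm]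
    refine Finset.sum_congr rfl fun S _ => ?_
    rw [Finset.mul_sum, Finset.mul_sum]
    exact Finset.sum_congr rfl fun T _ => by ring
  rw [hXsplit] at hX
  rw [← neg_sq, ← hX]
  nlinarith [sq_nonneg ((∑ x : (Fin M → Finset (Fin k)) × Finset (Fin N),
        u * samplingProb p x.2 * e x.2 x.1 * W x.1) +
      ∑ x : (Fin M → Finset (Fin k)) × Finset (Fin N),
        u * samplingProb p x.2 * e x.2 x.1 * L x.2 x.1)]

end Parity

/-! ### Disjoint split graphs with hidden parities -/

section Blocks

variable {N M k ℓ : ℕ}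

/-- The vertex `u` lies in the core of a block (its first `k` vertices, out of `k + ℓ`) that
contains `v`, and it is to be joined to `v` if `u < v`: either `v` is in the core as well, or the
position of `u` belongs to the set `T b` of the block. -/
def Attached (ℓ : ℕ) (T : Fin M → Finset (Fin k)) (u v : ℕ) : Prop :=
  ∃ (b : Fin M) (i : Fin k), u / (k + ℓ) = b ∧ v / (k + ℓ) = b ∧ u % (k + ℓ) = i ∧
    (v % (k + ℓ) < k ∨ i ∈ T b)

/-- The graph on `Fin N` made of `M` consecutive blocks of `k + ℓ` vertices and of isolated
vertices: the first `k` vertices of a block form a clique, and each of its `ℓ` other vertices has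
as neighbours the vertices of the clique with position in `T b`. -/
def blockGraph (N ℓ : ℕ) (T : Fin M → Finset (Fin k)) : SimpleGraph (Fin N) where
  Adj u v := (u < v ∧ Attached ℓ T u v) ∨ (v < u ∧ Attached ℓ T v u)
  symm := ⟨fun _ _ h => h.symm⟩
  loopless := ⟨fun u h => by simp at h⟩

lemma mem_earlier_blockGraph {T : Fin M → Finset (Fin k)} {u v : Fin N} :
    u ∈ earlier (blockGraph N ℓ T) Fin.val v ↔ u < v ∧ Attached ℓ T u v := by
  rw [mem_earlier]
  constructor
  · rintro ⟨h | h, hlt⟩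
    · exact h
    · exact absurd h.1 (lt_asymm hlt)
  · rintro ⟨hlt, h⟩
    exact ⟨Or.inl ⟨hlt, h⟩, hlt⟩

lemma isPEO_blockGraph (T : Fin M → Finset (Fin k)) : IsPEO (blockGraph N ℓ T) Fin.val where
  inj := Fin.val_injective
  clique := by
    have key : ∀ v x y : Fin N, Attached ℓ T x v → Attached ℓ T y v → Attached ℓ T x y := by
      rintro v x y ⟨b, i, hb, hvb, hi, -⟩ ⟨c, j, hc, hvc, hj, -⟩
      exact ⟨b, i, hb, by omega, hi, Or.inl (hj ▸ j.2)⟩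
    intro v x hx y hy hxy
    rw [mem_earlier_blockGraph] at hx hy
    rcases lt_or_gt_of_ne hxy with h | h
    · exact Or.inl ⟨h, key v x y hx.2 hy.2⟩
    · exact Or.inr ⟨h, key v y x hy.2 hx.2⟩

lemma eq_of_div_eq_of_mod_eq {u v : Fin N} {s : ℕ} (h1 : u.val / s = v.val / s)
    (h2 : u.val % s = v.val % s) : u = v := by
  rw [Fin.ext_iff, ← Nat.div_add_mod u.val s, ← Nat.div_add_mod v.val s, h1, h2]

lemma card_earlier_blockGraph_le (T : Fin M → Finset (Fin k)) (v : Fin N) :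
    (earlier (blockGraph N ℓ T) Fin.val v).card ≤ k := by
  refine (Finset.card_le_card_of_injOn (t := Finset.range k) (fun u => u.val % (k + ℓ)) ?_
    ?_).trans (Finset.card_range k).le
  · intro u hu
    obtain ⟨-, b, i, -, -, hi, -⟩ := mem_earlier_blockGraph.1 hu
    simp [hi]
  · intro u hu w hw huw
    obtain ⟨-, b, i, hb, hvb, -⟩ := mem_earlier_blockGraph.1 hu
    obtain ⟨-, c, j, hc, hvc, -⟩ := mem_earlier_blockGraph.1 hw
    exact eq_of_div_eq_of_mod_eq (by omega) huw

lemma maxDegree_blockGraph_le (hk : 1 ≤ k) (T : Fin M → Finset (Fin k)) :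
    open Classical in (blockGraph N ℓ T).maxDegree ≤ k + ℓ - 1 := by
  classical
  refine SimpleGraph.maxDegree_le_of_forall_degree_le _ _ fun v => ?_
  have hv : v.val % (k + ℓ) ∈ Finset.range (k + ℓ) :=
    Finset.mem_range.2 (Nat.mod_lt _ (by omega))
  rw [← SimpleGraph.card_neighborFinset_eq_degree, ← Finset.card_range (k + ℓ),
    ← Finset.card_erase_of_mem hv]
  have hblock : ∀ u, (blockGraph N ℓ T).Adj v u → u.val / (k + ℓ) = v.val / (k + ℓ) := by
    rintro u (⟨-, b, i, h1, h2, -⟩ | ⟨-, b, i, h1, h2, -⟩) <;> omega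
  refine Finset.card_le_card_of_injOn (fun u => u.val % (k + ℓ)) ?_ ?_
  · intro u hu
    have hadj := (SimpleGraph.mem_neighborFinset _ _ _).1 (Finset.mem_coe.1 hu)
    refine Finset.mem_coe.2 (Finset.mem_erase.2 ⟨fun h => ?_, ?_⟩)
    · exact hadj.ne (eq_of_div_eq_of_mod_eq (hblock u hadj) h).symm
    · exact Finset.mem_range.2 (Nat.mod_lt _ (by omega))
  · intro u hu w hw huw
    have h1 := hblock u ((SimpleGraph.mem_neighborFinset _ _ _).1 (Finset.mem_coe.1 hu))
    have h2 := hblock w ((SimpleGraph.mem_neighborFinset _ _ _).1 (Finset.mem_coe.1 hw))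
    exact eq_of_div_eq_of_mod_eq (h1.trans h2.symm) huw

lemma blockGraph_mem_chordalClass {d ω : ℕ} (hk : 1 ≤ k) (hω : k + 1 ≤ ω) (hd : k + ℓ ≤ d + 1)
    (T : Fin M → Finset (Fin k)) : blockGraph N ℓ T ∈ chordalClass N d ω := by
  have hr := isPEO_blockGraph (N := N) (ℓ := ℓ) T
  refine ⟨hr.isChordal, (maxDegree_blockGraph_le hk T).trans (by omega), ?_⟩
  exact hr.cliqueNum_le fun v => by
    have := card_earlier_blockGraph_le (ℓ := ℓ) T v
    omega

lemma card_block_positions {s b c e : ℕ} (hbN : (b + 1) * s ≤ N) (hes : e ≤ s) :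
    (Finset.univ.filter fun v : Fin N => v.val / s = b ∧ c ≤ v.val % s ∧ v.val % s < e).card =
      e - c := by
  have h : (Finset.univ.filter fun v : Fin N =>
      v.val / s = b ∧ c ≤ v.val % s ∧ v.val % s < e).map Fin.valEmbedding =
      Finset.Ico (s * b + c) (s * b + e) := by
    ext x
    simp only [Finset.mem_map, Finset.mem_filter, Finset.mem_univ, true_and,
      Fin.valEmbedding_apply, Finset.mem_Ico]
    constructor
    · rintro ⟨v, ⟨rfl, h1, h2⟩, rfl⟩
      have := Nat.div_add_mod v.val s
      omega
    · rintro ⟨h1, h2⟩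
      have hxN : x < N := by
        have : s * b + s ≤ N := by
          rw [add_mul, one_mul, mul_comm] at hbN
          exact hbN
        omega
      obtain ⟨j, rfl⟩ : ∃ j, x = s * b + j := ⟨x - s * b, by omega⟩
      have hdiv : (s * b + j) / s = b := by
        rw [Nat.mul_add_div (by omega), Nat.div_eq_of_lt (by omega), add_zero]
      have hmod : (s * b + j) % s = j := by
        rw [Nat.mul_add_mod, Nat.mod_eq_of_lt (by omega)]
      refine ⟨⟨s * b + j, hxN⟩, ⟨hdiv, ?_, ?_⟩, rfl⟩ <;> simp only [hmod] <;> omega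
  rw [← Finset.card_map Fin.valEmbedding, h, Nat.card_Ico]
  omega

/-- A vertex without earlier neighbours is isolated outside the blocks, or the first vertex of a
block, or a vertex outside the core of a block with `T b = ∅`. -/
lemma earlier_blockGraph_eq_empty_iff (hk : 1 ≤ k) (T : Fin M → Finset (Fin k)) (v : Fin N) :
    earlier (blockGraph N ℓ T) Fin.val v = ∅ ↔
      (M ≤ v.val / (k + ℓ) ∨ v.val % (k + ℓ) = 0) ∨
        ∃ b : Fin M, (v.val / (k + ℓ) = b ∧ k ≤ v.val % (k + ℓ) ∧ v.val % (k + ℓ) < k + ℓ) ∧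
          T b = ∅ := by
  have hdm := Nat.div_add_mod v.val (k + ℓ)
  have hmod := Nat.mod_lt v.val (show 0 < k + ℓ by omega)
  constructor
  · intro h
    by_contra hcon
    push Not at hcon
    obtain ⟨⟨hM, h0⟩, hT⟩ := hcon
    -- The vertex at a suitable position of the core is an earlier neighbour.
    have hex : ∃ i : Fin k, i.val < v.val % (k + ℓ) ∧
        (v.val % (k + ℓ) < k ∨ i ∈ T ⟨v.val / (k + ℓ), hM⟩) := by
      by_cases hc : v.val % (k + ℓ) < k
      · exact ⟨⟨0, hk⟩, Nat.pos_of_ne_zero h0, Or.inl hc⟩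
      · obtain ⟨i, hi⟩ := hT ⟨v.val / (k + ℓ), hM⟩ ⟨rfl, by omega, hmod⟩
        exact ⟨i, by omega, Or.inr hi⟩
    obtain ⟨i, hi, hor⟩ := hex
    have hik : i.val < k + ℓ := hi.trans hmod
    have hdiv : ((k + ℓ) * (v.val / (k + ℓ)) + i.val) / (k + ℓ) = v.val / (k + ℓ) := by
      rw [Nat.mul_add_div (by omega), Nat.div_eq_of_lt hik, add_zero]
    have hmodi : ((k + ℓ) * (v.val / (k + ℓ)) + i.val) % (k + ℓ) = i.val := by
      rw [Nat.mul_add_mod, Nat.mod_eq_of_lt hik]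
    have hmem : (⟨(k + ℓ) * (v.val / (k + ℓ)) + i.val, by have := v.2; omega⟩ : Fin N) ∈
        earlier (blockGraph N ℓ T) Fin.val v := by
      refine mem_earlier_blockGraph.2 ⟨?_, ⟨v.val / (k + ℓ), hM⟩, i, hdiv, rfl, hmodi, hor⟩
      rw [Fin.lt_def]
      simp only
      omega
    rw [h] at hmem
    simp at hmem
  · intro h
    refine Finset.eq_empty_of_forall_notMem fun u hu => ?_
    obtain ⟨hlt, b, i, hub, hvb, hi, hor⟩ := mem_earlier_blockGraph.1 hu
    rcases h with (hM | h0) | ⟨c, ⟨hc, hkv, -⟩, hT⟩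
    · have := b.2
      omega
    · have hu2 := Nat.div_add_mod u.val (k + ℓ)
      rw [hub, ← hvb] at hu2
      rw [Fin.lt_def] at hlt
      omega
    · have hbc : b = c := Fin.ext (by omega)
      rw [hbc, hT] at hor
      rcases hor with h | h
      · omega
      · simp at h

lemma cc_blockGraph (hk : 1 ≤ k) (hMN : M * (k + ℓ) ≤ N) (T : Fin M → Finset (Fin k)) :
    (cc (blockGraph N ℓ T) : ℝ) =
      (∑ v : Fin N, if M ≤ v.val / (k + ℓ) ∨ v.val % (k + ℓ) = 0 then 1 else 0) +
        ℓ * ∑ b, if T b = ∅ then 1 else 0 := by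
  rw [(isPEO_blockGraph T).cc_eq, Finset.card_filter]
  push_cast
  have hv : ∀ v : Fin N, (if earlier (blockGraph N ℓ T) Fin.val v = ∅ then (1 : ℝ) else 0) =
      (if M ≤ v.val / (k + ℓ) ∨ v.val % (k + ℓ) = 0 then 1 else 0) +
      ∑ b : Fin M, (if v.val / (k + ℓ) = b ∧ k ≤ v.val % (k + ℓ) ∧ v.val % (k + ℓ) < k + ℓ
        then 1 else 0) * (if T b = ∅ then 1 else 0) := by
    intro v
    rw [if_congr (earlier_blockGraph_eq_empty_iff hk T v) rfl rfl]
    have hmod := Nat.mod_lt v.val (show 0 < k + ℓ by omega)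
    by_cases hfix : M ≤ v.val / (k + ℓ) ∨ v.val % (k + ℓ) = 0
    · rw [if_pos (Or.inl hfix), if_pos hfix, Finset.sum_eq_zero, add_zero]
      intro b _
      have hb := b.2
      rw [if_neg (by omega), zero_mul]
    · have hM : v.val / (k + ℓ) < M := by omega
      rw [if_neg hfix, zero_add, Finset.sum_eq_single ⟨v.val / (k + ℓ), hM⟩]
      · by_cases hkv : k ≤ v.val % (k + ℓ)
        · by_cases hT : T ⟨v.val / (k + ℓ), hM⟩ = ∅
          · rw [if_pos (Or.inr ⟨⟨_, hM⟩, ⟨rfl, hkv, hmod⟩, hT⟩), if_pos ⟨rfl, hkv, hmod⟩,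
              if_pos hT, one_mul]
          · rw [if_neg, if_neg hT, mul_zero]
            rintro (h | ⟨b, ⟨hb, -⟩, hTb⟩)
            · exact hfix h
            · apply hT
              rw [← hTb]
              congr 1
              exact Fin.ext hb
        · rw [if_neg, if_neg (fun h => hkv h.2.1), zero_mul]
          rintro (h | ⟨b, ⟨-, h, -⟩, -⟩)
          · exact hfix h
          · exact hkv h
      · intro b _ hb
        rw [if_neg, zero_mul]
        rintro ⟨h, -⟩
        exact hb (Fin.ext h.symm)
      · simp
  simp_rw [hv]
  rw [Finset.sum_add_distrib, Finset.sum_comm, Finset.mul_sum]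
  congr 1
  refine Finset.sum_congr rfl fun b _ => ?_
  have hbN : (b.val + 1) * (k + ℓ) ≤ N := (Nat.mul_le_mul_right _ b.2).trans hMN
  rw [← Finset.sum_mul, Finset.sum_boole, card_block_positions hbN le_rfl]
  simp

lemma mem_toggle {T : Fin M → Finset (Fin k)} {b c : Fin M} {i j : Fin k}
    (h : ¬ (c = b ∧ j = i)) : j ∈ toggle T b i c ↔ j ∈ T c := by
  rw [toggle]
  by_cases hc : c = b
  · subst hc
    have hj : j ≠ i := fun hj => h ⟨rfl, hj⟩
    simp [Finset.mem_symmDiff, hj]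
  · rw [Function.update_of_ne hc]

lemma induce_blockGraph_congr {T T' : Fin M → Finset (Fin k)} {S : Finset (Fin N)}
    (h : ∀ u ∈ S, ∀ v ∈ S, ∀ (b : Fin M) (i : Fin k), u.val / (k + ℓ) = b →
      v.val / (k + ℓ) = b → u.val % (k + ℓ) = i → k ≤ v.val % (k + ℓ) → (i ∈ T' b ↔ i ∈ T b)) :
    (blockGraph N ℓ T').induce (S : Set (Fin N)) = (blockGraph N ℓ T).induce (S : Set (Fin N)) := by
  have hatt : ∀ u ∈ S, ∀ v ∈ S, (Attached ℓ T' u v ↔ Attached ℓ T u v) := by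
    intro u hu v hv
    refine exists_congr fun b => exists_congr fun i => ?_
    refine and_congr_right fun h1 => and_congr_right fun h2 => and_congr_right fun h3 => ?_
    by_cases hkv : v.val % (k + ℓ) < k
    · simp [hkv]
    · simp only [hkv, false_or]
      exact h u hu v hv b i h1 h2 h3 (not_lt.1 hkv)
  ext ⟨u, hu⟩ ⟨v, hv⟩
  rw [SimpleGraph.comap_adj, SimpleGraph.comap_adj]
  exact or_congr (and_congr_right fun _ => hatt u hu v hv) (and_congr_right fun _ => hatt v hv u hu)

/-- In the block graphs, the parity of `T b` is hidden if a vertex of the core is not observed,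
since it might or might not be a neighbour of the others. If there is only one vertex outside the
core, then the parity is also hidden if that vertex is not observed. -/
noncomputable def blockFamily {a : ℕ} (hk : 1 ≤ k) (hMN : M * (k + ℓ) ≤ N)
    (ha : a = k ∨ (a = k + 1 ∧ ℓ = 1)) : HiddenParity N M k ℓ a where
  graph := blockGraph N ℓ
  A b := Finset.univ.filter fun v : Fin N =>
    v.val / (k + ℓ) = b ∧ 0 ≤ v.val % (k + ℓ) ∧ v.val % (k + ℓ) < a
  disjoint b c hbc := by
    rw [Finset.disjoint_left]
    intro v hv hw
    have h1 := (Finset.mem_filter.1 hv).2.1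
    have h2 := (Finset.mem_filter.1 hw).2.1
    exact hbc (Fin.ext (by omega))
  card_A b := card_block_positions ((Nat.mul_le_mul_right _ b.2).trans hMN) (by omega)
  hidden S b hb := by
    obtain ⟨w, hw, hwS⟩ := Finset.not_subset.1 hb
    obtain ⟨-, hwb, -, hwa⟩ := Finset.mem_filter.1 hw
    by_cases hwk : w.val % (k + ℓ) < k
    · refine ⟨⟨w.val % (k + ℓ), hwk⟩, fun T => induce_blockGraph_congr ?_⟩
      intro u hu v _ c i huc _ hui _
      refine mem_toggle ?_
      rintro ⟨rfl, rfl⟩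
      exact hwS (eq_of_div_eq_of_mod_eq (huc.trans hwb.symm) hui ▸ hu)
    · refine ⟨⟨0, hk⟩, fun T => induce_blockGraph_congr ?_⟩
      intro u _ v hv c i _ hvc _ hkv
      refine mem_toggle ?_
      rintro ⟨rfl, -⟩
      have hmod := Nat.mod_lt v.val (show 0 < k + ℓ by omega)
      exact hwS (eq_of_div_eq_of_mod_eq (hvc.trans hwb.symm) (by omega) ▸ hv)
  base := ∑ v : Fin N, if M ≤ v.val / (k + ℓ) ∨ v.val % (k + ℓ) = 0 then 1 else 0
  cc_graph := cc_blockGraph hk hMN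

end Blocks

/-! ### The minimax lower bound -/

section Lower

variable {N d ω : ℕ} {p : ℝ}

lemma minimaxRisk_nonneg (h0 : 0 ≤ p) (h1 : p ≤ 1) : 0 ≤ minimaxRisk N d ω p :=
  Real.iInf_nonneg fun est => Real.iSup_nonneg fun G => mse_nonneg h0 h1 est G

/-- The bias `δ` of the parities is taken as large as possible with `M * δ ^ 2 * p ^ a ≤ 1`, so that
the second moment of the likelihood ratio stays bounded by a constant. -/
lemma HiddenParity.le_minimaxRisk {M k ℓ a : ℕ} (F : HiddenParity N M k ℓ a) (hk : 1 ≤ k)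
    (ha : 1 ≤ a) (hM : 1 ≤ M) (hF : ∀ T, F.graph T ∈ chordalClass N d ω) (h0 : 0 < p)
    (h1 : p ≤ 1 / 4) :
    ((ℓ : ℝ) * M) ^ 2 * min 1 (1 / (M * p ^ a)) ≤ 32 * 4 ^ k * minimaxRisk N d ω p := by
  have hM0 : (0 : ℝ) < M := by exact_mod_cast hM
  have hτ0 : 0 < p ^ a := pow_pos h0 a
  have hτ : p ^ a ≤ 1 / 2 :=
    (pow_le_of_le_one h0.le (by linarith) (by omega)).trans (by linarith)
  have hmin0 : 0 ≤ min 1 (1 / (M * p ^ a)) := by positivity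
  have hδ2 := Real.sq_sqrt hmin0
  have hx : M * (√(min 1 (1 / (M * p ^ a))) ^ 2 * p ^ a) ≤ 1 := by
    rw [hδ2]
    calc M * (min 1 (1 / (M * p ^ a)) * p ^ a) ≤ M * (1 / (M * p ^ a) * p ^ a) := by
          gcongr
          exact min_le_right _ _
      _ = 1 := by field_simp
  have hexp : (1 + √(min 1 (1 / (M * p ^ a))) ^ 2 * p ^ a) ^ M ≤ 3 := by
    refine le_trans ?_ Real.exp_one_lt_three.le
    calc (1 + √(min 1 (1 / (M * p ^ a))) ^ 2 * p ^ a) ^ M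
        ≤ (Real.exp (√(min 1 (1 / (M * p ^ a))) ^ 2 * p ^ a)) ^ M := by
          gcongr
          rw [add_comm]
          exact Real.add_one_le_exp _
      _ = Real.exp (M * (√(min 1 (1 / (M * p ^ a))) ^ 2 * p ^ a)) := by
          rw [← Real.exp_nat_mul]
      _ ≤ Real.exp 1 := Real.exp_le_exp.2 hx
  rw [← div_le_iff₀' (by positivity)]
  have : Nonempty (Estimator N) := ⟨fun _ _ => 0⟩
  refine le_ciInf fun est => ?_
  rw [div_le_iff₀' (by positivity)]
  have hR : ∀ T, mse p est (F.graph T) ≤ ⨆ G : chordalClass N d ω, mse p est G.1 := fun T =>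
    le_ciSup (f := fun G : chordalClass N d ω => mse p est G.1)
      (Set.finite_range _).bddAbove ⟨F.graph T, hF T⟩
  have hRnn : 0 ≤ ⨆ G : chordalClass N d ω, mse p est G.1 :=
    Real.iSup_nonneg fun G => mse_nonneg h0.le (by linarith) est G
  have hmain := F.le_of_mse_le hk h0.le (by linarith) (Real.sqrt_nonneg _)
    (Real.sqrt_le_one.2 (min_le_left 1 (1 / (M * p ^ a)))) est hR
  generalize (⨆ G : chordalClass N d ω, mse p est G.1) = R at hmain hRnn
  have hfour : (((2 : ℝ) ^ k)⁻¹) ^ 2 = (4 ^ k)⁻¹ := by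
    rw [inv_pow, ← pow_mul, mul_comm, pow_mul]
    norm_num
  have hleft : (ℓ * M * ((2 : ℝ) ^ k)⁻¹ * √(min 1 (1 / (M * p ^ a))) * (1 - p ^ a)) ^ 2 =
      (4 ^ k)⁻¹ * (((ℓ : ℝ) * M) ^ 2 * min 1 (1 / (M * p ^ a))) * (1 - p ^ a) ^ 2 := by
    rw [mul_pow, mul_pow, mul_pow, hfour, hδ2]
    ring
  rw [hleft] at hmain
  have hY : 0 ≤ (4 ^ k)⁻¹ * (((ℓ : ℝ) * M) ^ 2 * min 1 (1 / (M * p ^ a))) := by positivity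
  have hsq : 1 / 4 ≤ (1 - p ^ a) ^ 2 := by nlinarith
  have h8 := mul_le_mul_of_nonneg_left hexp hRnn
  have h9 := mul_le_mul_of_nonneg_left hsq hY
  have h10 : (4 ^ k)⁻¹ * (((ℓ : ℝ) * M) ^ 2 * min 1 (1 / (M * p ^ a))) ≤ 32 * R := by linarith
  rw [inv_mul_le_iff₀ (by positivity)] at h10
  linarith

/-- Blocks with one vertex outside the core, whose parity is seen only if the whole block is. -/
lemma min_div_pow_le_minimaxRisk (hω : 2 ≤ ω) (hd : ω ≤ d + 1) (hN : ω ≤ N) (h0 : 0 < p)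
    (h1 : p ≤ 1 / 4) :
    min ((N : ℝ) / p ^ ω) ((N : ℝ) ^ 2) ≤ 128 * ω ^ 2 * 4 ^ ω * minimaxRisk N d ω p := by
  obtain ⟨k, rfl⟩ : ∃ k, ω = k + 1 := ⟨ω - 1, by omega⟩
  obtain ⟨M, hMdef⟩ : ∃ M, M = N / (k + 1) := ⟨_, rfl⟩
  have hM : 1 ≤ M := hMdef ▸ Nat.div_pos hN (by omega)
  have hMN : M * (k + 1) ≤ N := hMdef ▸ Nat.div_mul_le_self _ _
  have hNM : N ≤ 2 * ((k + 1) * M) := by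
    have h2 := Nat.div_add_mod N (k + 1)
    have h3 := Nat.mod_lt N (show 0 < k + 1 by omega)
    rw [← hMdef] at h2
    nlinarith
  have hk : 1 ≤ k := by omega
  have hmain := (blockFamily (a := k + 1) hk hMN (Or.inr ⟨rfl, rfl⟩)).le_minimaxRisk (d := d)
    (ω := k + 1) hk (by omega) hM
    (fun T => blockGraph_mem_chordalClass hk le_rfl (by omega) T) h0 h1
  have hNM' : (N : ℝ) ≤ 2 * ((k + 1 : ℕ) * M) := by exact_mod_cast hNM
  have hM0 : (0 : ℝ) < M := by exact_mod_cast hM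
  have hτ := pow_pos h0 (k + 1)
  have hω1 : (1 : ℝ) ≤ (k + 1 : ℕ) := by exact_mod_cast (by omega : 1 ≤ k + 1)
  have hRnn := minimaxRisk_nonneg (N := N) (d := d) (ω := k + 1) h0.le (by linarith)
  have hle : min ((N : ℝ) / p ^ (k + 1)) ((N : ℝ) ^ 2) ≤
      4 * ((k + 1 : ℕ) : ℝ) ^ 2 * (((1 : ℕ) * (M : ℝ)) ^ 2 * min 1 (1 / (M * p ^ (k + 1)))) := by
    rw [mul_min_of_nonneg _ _ (by positivity), mul_min_of_nonneg _ _ (by positivity), min_comm]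
    refine min_le_min ?_ ?_
    · calc (N : ℝ) ^ 2 ≤ (2 * ((k + 1 : ℕ) * M)) ^ 2 := by gcongr
        _ = _ := by push_cast; ring
    · have hrhs : 4 * ((k + 1 : ℕ) : ℝ) ^ 2 *
          (((1 : ℕ) * (M : ℝ)) ^ 2 * (1 / (M * p ^ (k + 1)))) =
          4 * ((k + 1 : ℕ) : ℝ) ^ 2 * M / p ^ (k + 1) := by
        push_cast
        field_simp
      rw [hrhs]
      gcongr
      nlinarith [mul_le_mul_of_nonneg_right hω1 (mul_nonneg (zero_le_one.trans hω1) hM0.le)]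
  refine hle.trans ((mul_le_mul_of_nonneg_left hmain (by positivity)).trans ?_)
  calc 4 * ((k + 1 : ℕ) : ℝ) ^ 2 * (32 * 4 ^ k * minimaxRisk N d (k + 1) p)
      = 128 * ((k + 1 : ℕ) : ℝ) ^ 2 * 4 ^ k * minimaxRisk N d (k + 1) p := by ring
    _ ≤ _ := by
        gcongr
        · norm_num
        · omega

/-- Blocks that are as large as the degree bound and `N` allow, whose parity is seen only if the
whole core is. -/
lemma min_mul_div_pow_le_minimaxRisk (hω : 2 ≤ ω) (hd : ω ≤ d + 1) (hN : ω ≤ N) (h0 : 0 < p)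
    (h1 : p ≤ 1 / 4) :
    min ((N : ℝ) * d / p ^ (ω - 1)) ((N : ℝ) ^ 2) ≤
      128 * ω ^ 2 * 4 ^ ω * minimaxRisk N d ω p := by
  obtain ⟨k, rfl⟩ : ∃ k, ω = k + 1 := ⟨ω - 1, by omega⟩
  rw [Nat.add_sub_cancel]
  have hk : 1 ≤ k := by omega
  obtain ⟨ℓ, hℓ⟩ : ∃ ℓ, k + ℓ = min (d + 1) N := ⟨min (d + 1) N - k, by omega⟩
  have hℓ1 : 1 ≤ ℓ := by omega
  obtain ⟨M, hMdef⟩ : ∃ M, M = N / (k + ℓ) := ⟨_, rfl⟩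
  have hM : 1 ≤ M := hMdef ▸ Nat.div_pos (by omega) (by omega)
  have hMN : M * (k + ℓ) ≤ N := hMdef ▸ Nat.div_mul_le_self _ _
  have hs : k + ℓ ≤ (k + 1) * ℓ := by nlinarith
  have hNM : N ≤ 2 * ((k + 1) * (ℓ * M)) := by
    have h2 := Nat.div_add_mod N (k + ℓ)
    have h3 := Nat.mod_lt N (show 0 < k + ℓ by omega)
    rw [← hMdef] at h2
    have h4 : (k + ℓ) * M ≤ (k + 1) * ℓ * M := Nat.mul_le_mul_right _ hs
    have h5 : (k + ℓ) * 1 ≤ (k + ℓ) * M := Nat.mul_le_mul_left _ hM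
    rw [mul_assoc] at h4
    omega
  have hmain := (blockFamily (a := k) hk hMN (Or.inl rfl)).le_minimaxRisk (d := d)
    (ω := k + 1) hk hk hM
    (fun T => blockGraph_mem_chordalClass hk le_rfl (by omega) T) h0 h1
  have hNM' : (N : ℝ) ≤ 2 * ((k + 1 : ℕ) * (ℓ * M)) := by exact_mod_cast hNM
  have hM0 : (0 : ℝ) < M := by exact_mod_cast hM
  have hℓ0 : (0 : ℝ) < ℓ := by exact_mod_cast hℓ1
  have hτ := pow_pos h0 k
  have hRnn := minimaxRisk_nonneg (N := N) (d := d) (ω := k + 1) h0.le (by linarith)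
  have hfirst : (N : ℝ) ^ 2 ≤ 4 * ((k + 1 : ℕ) : ℝ) ^ 2 * ((ℓ : ℝ) * M) ^ 2 :=
    calc (N : ℝ) ^ 2 ≤ (2 * ((k + 1 : ℕ) * (ℓ * M))) ^ 2 := by gcongr
      _ = _ := by ring
  have hle : min ((N : ℝ) * d / p ^ k) ((N : ℝ) ^ 2) ≤
      4 * ((k + 1 : ℕ) : ℝ) ^ 2 * (((ℓ : ℝ) * M) ^ 2 * min 1 (1 / (M * p ^ k))) := by
    by_cases hM1 : M = 1
    · -- A single block: its parity is hidden with probability at least `1 / 2`.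
      have hmin : min 1 (1 / ((M : ℝ) * p ^ k)) = 1 := by
        refine min_eq_left ?_
        rw [hM1, Nat.cast_one, one_mul, le_div_iff₀ hτ, one_mul]
        exact pow_le_one₀ h0.le (by linarith)
      rw [hmin, mul_one]
      exact (min_le_right _ _).trans hfirst
    · have hdk : d + 1 = k + ℓ := by
        have : 2 * (k + ℓ) ≤ M * (k + ℓ) := Nat.mul_le_mul_right _ (by omega)
        omega
      have hd' : (d : ℝ) ≤ (k + 1 : ℕ) * ℓ := by exact_mod_cast (by omega : d ≤ (k + 1) * ℓ)
      rw [mul_min_of_nonneg _ _ (by positivity), mul_min_of_nonneg _ _ (by positivity), min_comm]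
      refine min_le_min (by rw [mul_one]; exact hfirst) ?_
      have hrhs : 4 * ((k + 1 : ℕ) : ℝ) ^ 2 * (((ℓ : ℝ) * M) ^ 2 * (1 / (M * p ^ k))) =
          4 * ((k + 1 : ℕ) * (ℓ * M)) * ((k + 1 : ℕ) * ℓ) / p ^ k := by
        field_simp
      rw [hrhs]
      gcongr
      have hpos : (0 : ℝ) ≤ (k + 1 : ℕ) * (ℓ * M) := by positivity
      linarith
  refine hle.trans ((mul_le_mul_of_nonneg_left hmain (by positivity)).trans ?_)
  calc 4 * ((k + 1 : ℕ) : ℝ) ^ 2 * (32 * 4 ^ k * minimaxRisk N d (k + 1) p)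
      = 128 * ((k + 1 : ℕ) : ℝ) ^ 2 * 4 ^ k * minimaxRisk N d (k + 1) p := by ring
    _ ≤ _ := by
        gcongr
        · norm_num
        · omega

/-- A single edge that may or may not be there. -/
lemma one_le_minimaxRisk (hω : 2 ≤ ω) (hd : ω ≤ d + 1) (hN : 2 ≤ N) (h0 : 0 < p)
    (h1 : p ≤ 1 / 4) : 1 ≤ 128 * minimaxRisk N d ω p := by
  have hMN : 1 * (1 + 1) ≤ N := by omega
  have hmain := (blockFamily (a := 1) le_rfl hMN (Or.inl rfl)).le_minimaxRisk (d := d)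
    (ω := ω) le_rfl le_rfl le_rfl
    (fun T => blockGraph_mem_chordalClass le_rfl (by omega) (by omega) T) h0 h1
  have hmin : min (1 : ℝ) (1 / ((1 : ℕ) * p ^ 1)) = 1 := by
    refine min_eq_left ?_
    rw [Nat.cast_one, one_mul, pow_one, le_div_iff₀ h0]
    linarith
  rw [hmin] at hmain
  norm_num at hmain
  exact hmain

lemma rate_le_minimaxRisk (hω : 2 ≤ ω) (hd : ω ≤ d + 1) (hN : 2 ≤ N) (h0 : 0 < p)
    (h1 : p ≤ 1 / 4) : rate N d ω p ≤ 128 * ω ^ 2 * 4 ^ ω * minimaxRisk N d ω p := by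
  rcases Nat.lt_or_ge N ω with hNω | hNω
  · have hN' : (N : ℝ) ≤ ω := by exact_mod_cast hNω.le
    have hone := one_le_minimaxRisk hω hd hN h0 h1
    have hfour : (1 : ℝ) ≤ 4 ^ ω := one_le_pow₀ (by norm_num)
    calc rate N d ω p ≤ (N : ℝ) ^ 2 := min_le_right _ _
      _ ≤ (ω : ℝ) ^ 2 * 1 * 1 := by
          rw [mul_one, mul_one]
          gcongr
      _ ≤ (ω : ℝ) ^ 2 * 4 ^ ω * (128 * minimaxRisk N d ω p) := by gcongr
      _ = _ := by ring
  · rw [rate, min_max_distrib_right]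
    exact max_le (min_div_pow_le_minimaxRisk hω hd hNω h0 h1)
      (min_mul_div_pow_le_minimaxRisk hω hd hNω h0 h1)

end Lower

end SubgraphSampling

theorem theorem1 :
    (∀ ω : ℕ, 2 ≤ ω →
      (∃ C : ℝ, 0 < C ∧ ∀ (N d : ℕ) (p : ℝ), 0 < p → p ≤ 1 →
        SubgraphSampling.minimaxRisk N d ω p ≤ C * SubgraphSampling.rate N d ω p) ∧
      (∃ p₀ c : ℝ, 0 < p₀ ∧ p₀ < 1 / 2 ∧ 0 < c ∧
        ∀ (N d : ℕ) (p : ℝ), 2 ≤ N → ω ≤ d + 1 → 0 < p → p ≤ p₀ →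
          c * SubgraphSampling.rate N d ω p ≤ SubgraphSampling.minimaxRisk N d ω p)) ∧
    (∀ (N d ω : ℕ) (p : ℝ), 1 / 2 ≤ p → p ≤ 1 →
      SubgraphSampling.minimaxRisk N d ω p ≤ (N : ℝ) * ((1 - p) / p) * ((d : ℝ) + 1)) := by
  refine ⟨fun ω hω => ⟨⟨2, two_pos, fun N d p h0 h1 =>
    SubgraphSampling.minimaxRisk_le_rate h0 h1⟩, 1 / 4, (128 * (ω : ℝ) ^ 2 * 4 ^ ω)⁻¹,
    by norm_num, by norm_num, ?_, fun N d p hN hd h0 h1 => ?_⟩,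
    fun N d ω p h0 h1 => SubgraphSampling.minimaxRisk_le_of_half_le h0 h1⟩
  · have : (0 : ℝ) < ω := by exact_mod_cast (by omega : 0 < ω)
    positivity
  · have : (0 : ℝ) < ω := by exact_mod_cast (by omega : 0 < ω)
    rw [inv_mul_le_iff₀ (by positivity)]
    exact SubgraphSampling.rate_le_minimaxRisk hω hd hN h0 h1
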